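/- Let $\mathcal X,\mathcal S,\mathcal Y,\mathcal Z,\hat{\mathcal S}$ be finite alphabets ($\hat{\mathcal S}\neq\emptyset$), $P_S$ a pmf on $\mathcal S$, $P_{YZ|SX}$ a channel transition law, $d\colon\mathcal S\times\hat{\mathcal S}\to[0,\infty)$ a distortion function and $b\colon\mathcal X\to[0,\infty)$ a cost function. A $(2^{nR},n)$ code consists of a finite message set $\mathcal W$ with $|\mathcal W|\ge 2^{nR}$, encoding functions $\phi_i\colon\mathcal W\times\mathcal Z^{i-1}\to\mathcal X$ for $1\le i\le n$, a decoder $g\colon\mathcal S^n\times\mathcal Y^n\to\mathcal W$, and a state estimator $h\colon\mathcal X^n\times\mathcal Z^n\to\hat{\mathcal S}^n$. The message $W$ is uniform on $\mathcal W$, the states $S_1,\dots,S_n$ are i.i.d. $\sim P_S$ and independent of $W$, the inputs are $X_i=\phi_i(W,Z^{i-1})$, and given everything up to then $(Y_i,Z_i)$ is drawn from $P_{YZ|SX}(\cdot,\cdot\mid S_i,X_i)$; put $\hat W=g(S^n,Y^n)$ and $\hat S^n=h(X^n,Z^n)$. A tuple $(R,D,B)$ with $R\ge 0$ is achievable if there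 is a sequence (in $n$) of $(2^{nR},n)$ codes with $$\lim_{n\to\infty}\Pr(\hat W\ne W)=0,\qquad \varlimsup_{n\to\infty}\frac1n\sum_{i=1}^n\mathbb E[d(S_i,\hat S_i)]\le D,\qquad \varlimsup_{n\to\infty}\frac1n\sum_{i=1}^n\mathbb E[b(X_i)]\le B.$$ Let $C(D,B)$ be the supremum of all $R$ such that $(R,D,B)$ is achievable. Let $\hat s^*(x,z)\in\arg\min_{s'\in\hat{\mathcal S}}\sum_{s}P_{S|XZ}(s|x,z)\,d(s,s')$ with ties broken arbitrarily, where $P_{S|XZ}(s|x,z)=P_S(s)P_{Z|SX}(z|s,x)\big/\sum_{\tilde s}P_S(\tilde s)P_{Z|SX}(z|\tilde s,x)$ (any value $\hat s^*(x,z)$ is allowed if the denominator is $0$), and let $c(x)=\sum_{s,z}P_S(s)P_{Z|SX}(z|s,x)\,d(s,\hat s^*(x,z))$. Let $\mathcal P_D$ and $\mathcal P_B$ be the sets of pmfs $P_X$ on $\mathcal X$ with $\sum_xP_X(x)c(x)\le D$ and $\sum_xP_X(x)b(x)\le B$, respectively, and put $D_{\min}(B)=\min_{P_X\in\mathcal P_B}\sum_xP_X(x)c(x)$.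 Then for all $B\ge 0$ with $\mathcal P_B\ne\emptyset$ and all $D\ge D_{\min}(B)$, the supremum defining $C(D,B)$ is finite, the maximum below is attained, and $$C(D,B)=C_{\inf}(D,B):=\max_{P_X\in\mathcal P_D\cap\mathcal P_B}I(X;Y\mid S),$$ where $(X,S,Y,Z)\sim P_XP_SP_{YZ|SX}$ and mutual information is measured in bits. -/

import Mathlib

open scoped NNReal

noncomputable section

namespace SDMC

/-- A state-dependent memoryless channel over finite alphabets: state pmf `P_S` and transition
law `P_{YZ|XS}`, written `law x s (y, z)`. -/
structure Channel (X S Y Z : Type*) [Fintype S] [Fintype Y] [Fintype Z] where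
  stateDist : S → ℝ
  law : X → S → Y × Z → ℝ
  stateDist_mem : stateDist ∈ stdSimplex ℝ S
  law_mem : ∀ x s, law x s ∈ stdSimplex ℝ (Y × Z)

/-- A code of block length `n` with message set `Fin M`. The encoder is strictly causal in the
feedback: the time-`i` input depends on the message and on the feedback symbols before time `i`. -/
structure Code (X S Y Z Shat : Type*) (M n : ℕ) where
  encode : (i : Fin n) → Fin M → (Fin i → Z) → X
  decode : (Fin n → S) → (Fin n → Y) → Fin M
  estimate : (Fin n → X) → (Fin n → Z) → (Fin n → Shat)

section

variable {X S Y Z Shat : Type*} [Fintype S] [Fintype Y] [Fintype Z]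

/-! ### Operational quantities -/

/-- The channel inputs `x_i = φ_i(w, z^{i-1})`. -/
def Code.input {M n : ℕ} (C : Code X S Y Z Shat M n) (w : Fin M) (z : Fin n → Z) (i : Fin n) : X :=
  C.encode i w (fun j => z (Fin.castLE i.isLt.le j))

/-- The joint pmf of `(W, S^n, Y^n, Z^n)` induced by a code: `W` is uniform, the states are
i.i.d. and independent of `W`, and each output pair is drawn from the channel law given the
current input and state. -/
def Code.jointLaw {M n : ℕ} (C : Code X S Y Z Shat M n) (ch : Channel X S Y Z)
    (w : Fin M) (s : Fin n → S) (y : Fin n → Y) (z : Fin n → Z) : ℝ :=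
  (1 / (M : ℝ)) * ∏ i, (ch.stateDist (s i) * ch.law (C.input w z i) (s i) (y i, z i))

/-- Expectation of a function of `(W, S^n, Y^n, Z^n)` under the law induced by a code. -/
def Code.expect {M n : ℕ} (C : Code X S Y Z Shat M n) (ch : Channel X S Y Z)
    (f : Fin M → (Fin n → S) → (Fin n → Y) → (Fin n → Z) → ℝ) : ℝ :=
  ∑ w, ∑ s, ∑ y, ∑ z, C.jointLaw ch w s y z * f w s y z

/-- The probability of decoding error `Pr(Ŵ ≠ W)`. -/
def Code.errorProb {M n : ℕ} (C : Code X S Y Z Shat M n) (ch : Channel X S Y Z) : ℝ :=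
  C.expect ch (fun w s y _ => if C.decode s y ≠ w then 1 else 0)

/-- The expected average per-block distortion `(1/n) ∑ E[d(S_i, Ŝ_i)]`. -/
def Code.distortion {M n : ℕ} (C : Code X S Y Z Shat M n) (ch : Channel X S Y Z)
    (d : S → Shat → ℝ≥0) : ℝ :=
  (1 / (n : ℝ)) * ∑ i, C.expect ch (fun w s _ z => (d (s i) (C.estimate (C.input w z) z i) : ℝ))

/-- The expected average input cost `(1/n) ∑ E[b(X_i)]`. -/
def Code.cost {M n : ℕ} (C : Code X S Y Z Shat M n) (ch : Channel X S Y Z)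
    (b : X → ℝ≥0) : ℝ :=
  (1 / (n : ℝ)) * ∑ i, C.expect ch (fun w _ _ z => (b (C.input w z i) : ℝ))

/-- Achievability of the rate-distortion-cost tuple `(R, D, B)`. -/
def Achievable (ch : Channel X S Y Z) (d : S → Shat → ℝ≥0) (b : X → ℝ≥0) (R D B : ℝ) : Prop :=
  0 ≤ R ∧ ∃ (M : ℕ → ℕ) (C : (n : ℕ) → Code X S Y Z Shat (M n) n),
    (∀ n : ℕ, (2 : ℝ) ^ ((n : ℝ) * R) ≤ (M n : ℝ)) ∧
    Filter.Tendsto (fun n => (C n).errorProb ch) Filter.atTop (nhds 0) ∧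
    Filter.limsup (fun n => (C n).distortion ch d) Filter.atTop ≤ D ∧
    Filter.limsup (fun n => (C n).cost ch b) Filter.atTop ≤ B

/-- The operational capacity-distortion-cost tradeoff: the supremum of all rates `R` for which
`(R, D, B)` is achievable. -/
def capacity (ch : Channel X S Y Z) (d : S → Shat → ℝ≥0) (b : X → ℝ≥0) (D B : ℝ) : ℝ :=
  sSup {R | Achievable ch d b R D B}

/-! ### Information-theoretic quantities -/

/-- Conditional mutual information `I(X;Y|S)` in bits of a joint pmf `p` of `(X, S, Y)`. -/
def condMutualInfo [Fintype X] (p : X → S → Y → ℝ) : ℝ :=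
  ∑ x, ∑ s, ∑ y, p x s y *
    Real.logb 2 (((∑ x', ∑ y', p x' s y') * p x s y) / ((∑ y', p x s y') * (∑ x', p x' s y)))

/-- `I(X;Y|S)` for `(X, S, Y, Z) ∼ P_X P_S P_{YZ|SX}`, as a function of `P_X`. -/
def Channel.info [Fintype X] (ch : Channel X S Y Z) (P : X → ℝ) : ℝ :=
  condMutualInfo (fun x s y => ∑ z, P x * ch.stateDist s * ch.law x s (y, z))

/-- The marginal `P_{Z|SX}(z|s,x)`. -/
def Channel.lawZ (ch : Channel X S Y Z) (x : X) (s : S) (z : Z) : ℝ :=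
  ∑ y, ch.law x s (y, z)

/-- The posterior `P_{S|XZ}(s|x,z)`. If `z` has probability zero given `x`, this is `0` for
every `s`, so that the estimate at `(x, z)` is unconstrained below. -/
def Channel.posterior (ch : Channel X S Y Z) (x : X) (z : Z) (s : S) : ℝ :=
  ch.stateDist s * ch.lawZ x s z / ∑ s', ch.stateDist s' * ch.lawZ x s' z

/-- `e` is an optimal symbol-wise estimator: `e x z` minimizes the posterior expected distortion
over the reconstruction alphabet; ties are broken arbitrarily. -/
def Channel.IsOptimalEstimator (ch : Channel X S Y Z) (d : S → Shat → ℝ≥0)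
    (e : X → Z → Shat) : Prop :=
  ∀ x z, ∀ t : Shat,
    ∑ s, ch.posterior x z s * (d s (e x z) : ℝ) ≤ ∑ s, ch.posterior x z s * (d s t : ℝ)

theorem Channel.exists_isOptimalEstimator [Finite Shat] [Nonempty Shat]
    (ch : Channel X S Y Z) (d : S → Shat → ℝ≥0) :
    ∃ e : X → Z → Shat, ch.IsOptimalEstimator d e := by
  choose e he using fun x z =>
    Finite.exists_min (fun t : Shat => ∑ s, ch.posterior x z s * (d s t : ℝ))
  exact ⟨e, he⟩

/-- The estimation cost `c(x) = E[d(S, e(X, Z)) | X = x]` of the symbol-wise estimator `e`. -/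
def Channel.estCost (ch : Channel X S Y Z) (d : S → Shat → ℝ≥0) (e : X → Z → Shat) (x : X) : ℝ :=
  ∑ s, ∑ z, ch.stateDist s * ch.lawZ x s z * (d s (e x z) : ℝ)

/-- Input pmfs `P_X` with `∑ P_X(x) c(x) ≤ D`. -/
def distortionSet [Fintype X] (c : X → ℝ) (D : ℝ) : Set (X → ℝ) :=
  {P | P ∈ stdSimplex ℝ X ∧ ∑ x, P x * c x ≤ D}

/-- Input pmfs `P_X` with `∑ P_X(x) b(x) ≤ B`. -/
def costSet [Fintype X] (b : X → ℝ≥0) (B : ℝ) : Set (X → ℝ) :=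
  {P | P ∈ stdSimplex ℝ X ∧ ∑ x, P x * (b x : ℝ) ≤ B}

/-- The minimum distortion `D_min(B)`. -/
def minDistortion [Fintype X] (c : X → ℝ) (b : X → ℝ≥0) (B : ℝ) : ℝ :=
  sInf ((fun P : X → ℝ => ∑ x, P x * c x) '' costSet b B)

/-- The information-theoretic tradeoff function `C_inf(D, B)`. -/
def infoTradeoff [Fintype X] (ch : Channel X S Y Z) (d : S → Shat → ℝ≥0) (b : X → ℝ≥0) (e : X → Z → Shat)
    (D B : ℝ) : ℝ :=
  sSup (ch.info '' (distortionSet (ch.estCost d e) D ∩ costSet b B))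

end

end SDMC

end

open scoped NNReal

noncomputable section

namespace SDMC

/-! ### Sums of products over finite function spaces -/

section ProductSums

variable {ι α : Type*} [Fintype ι] [DecidableEq ι] [Fintype α]

/-! Both directions rest on the information density `infoDensity` of the channel with output `(S,
Y)`.

Converse. Let `P` be the time-averaged input law `inputDist` of a code. The cost of the code is
linear in `P`. Its distortion is at least `∑ P(x) c(x)`: given the message and `z^n`, the weights of
the states factor over time, so the posterior of `S_i` involves only `(X_i, Z_i)` and the
symbol-wise estimator cannot be beaten (`Code.sum_inputDist_mul_estCost_le`). For the rate, let `L`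
be the sum over time of the densities taken against the output law of `P`; its mean is exactly `n
I(P)` in nats. Weighting the joint law by `exp (-L)` replaces the channel to `Y` by that output law,
under which `(S^n, Y^n)` says nothing about `W`. The feedback sums out causally, so it brings no
gain. With `t + 1 ≤ exp t` this gives the Fano-type bound `Code.one_sub_errorProb_mul_log_le`.
Compactness of the simplex and continuity of the information then produce a feasible limit law
(`Achievable.exists_le_info`).

Achievability. Ignore the feedback, draw an i.i.d. codebook from a feasible `P`, decode by a
likelihood threshold and estimate symbol by symbol. Chebyshev and a union bound control the mean
error, and variance bounds control the squared deviations of cost and distortion. The mean of the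
sum of the three is small, so one codebook makes all of them small (`exists_code_of_info`). -/

theorem sum_prod_eq_prod_sum (F : ι → α → ℝ) :
    ∑ a : ι → α, ∏ i, F i (a i) = ∏ i, ∑ x, F i x := by
  classical
  rw [Finset.prod_univ_sum, Fintype.piFinset_univ]

/-- Absorbing `f` into the factor at `k` keeps the summand a product over coordinates. -/
theorem sum_prod_mul_coord (F : ι → α → ℝ) (k : ι) (f : α → ℝ) :
    ∑ a : ι → α, (∏ i, F i (a i)) * f (a k)
      = (∏ i ∈ Finset.univ.erase k, ∑ x, F i x) * ∑ x, F k x * f x := by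
  have key := sum_prod_eq_prod_sum (fun i x => F i x * if i = k then f x else 1)
  simp only [Finset.prod_mul_distrib, Finset.prod_ite_eq', Finset.mem_univ, if_true] at key
  rw [key, ← Finset.prod_erase_mul _ _ (Finset.mem_univ k)]
  simp only [if_true]
  congr 1
  refine Finset.prod_congr rfl fun i hi => ?_
  simp [Finset.ne_of_mem_erase hi]

variable {p : α → ℝ}

theorem sum_iid (hp : ∑ x, p x = 1) : ∑ a : ι → α, ∏ i, p (a i) = 1 := by
  rw [sum_prod_eq_prod_sum (fun _ => p)]; simp [hp]

theorem sum_iid_mul_coord (hp : ∑ x, p x = 1) (k : ι) (f : α → ℝ) :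
    ∑ a : ι → α, (∏ i, p (a i)) * f (a k) = ∑ x, p x * f x := by
  rw [sum_prod_mul_coord (fun _ => p)]; simp [hp]

theorem sum_iid_mul_coord_mul_coord (hp : ∑ x, p x = 1) {k l : ι} (hkl : k ≠ l) (f g : α → ℝ) :
    ∑ a : ι → α, (∏ i, p (a i)) * (f (a k) * g (a l))
      = (∑ x, p x * f x) * ∑ x, p x * g x := by
  have key := sum_prod_mul_coord (fun i x => p x * if i = k then f x else 1) l g
  simp only [Finset.prod_mul_distrib, Finset.prod_ite_eq', Finset.mem_univ, if_true,
    if_neg hkl.symm, mul_one, mul_assoc] at key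
  rw [key, ← Finset.mul_prod_erase _ _ (Finset.mem_erase.2 ⟨hkl, Finset.mem_univ k⟩)]
  rw [Finset.prod_eq_one, mul_one]
  · simp
  · intro i hi
    simp [Finset.ne_of_mem_erase hi, hp]

/-- Cross terms vanish, since distinct coordinates are independent and `g` has mean zero; only the
diagonal survives. -/
theorem sum_iid_mul_sq_sum (hp : ∑ x, p x = 1) (g : α → ℝ) (hg : ∑ x, p x * g x = 0) :
    ∑ a : ι → α, (∏ i, p (a i)) * (∑ i, g (a i)) ^ 2
      = Fintype.card ι * ∑ x, p x * g x ^ 2 := by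
  have h : ∀ a : ι → α, (∏ i, p (a i)) * (∑ i, g (a i)) ^ 2
      = ∑ k, ∑ l, (∏ i, p (a i)) * (g (a k) * g (a l)) := by
    intro a
    rw [sq, Finset.sum_mul_sum, Finset.mul_sum]
    simp_rw [Finset.mul_sum]
  simp_rw [h]
  rw [Finset.sum_comm]
  have h2 : ∀ k : ι, ∑ a : ι → α, ∑ l, (∏ i, p (a i)) * (g (a k) * g (a l))
      = ∑ x, p x * g x ^ 2 := by
    intro k
    rw [Finset.sum_comm, Finset.sum_eq_single k]
    · simpa [sq] using sum_iid_mul_coord hp k (fun x => g x * g x)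
    · intro l _ hl
      rw [sum_iid_mul_coord_mul_coord hp hl.symm, hg, zero_mul]
    · simp
  simp [h2]

/-- A nonnegative function whose mean under a pmf is at most `r` takes a value at most `r`. -/
theorem exists_le_of_sum_mul_le {p f : α → ℝ} {r : ℝ} (hp0 : ∀ x, 0 ≤ p x) (hp : ∑ x, p x = 1)
    (h : ∑ x, p x * f x ≤ r) : ∃ x, f x ≤ r := by
  by_contra! hc
  have h1 : ∑ x, p x * (f x - r) ≤ 0 := by
    simp only [mul_sub, Finset.sum_sub_distrib, ← Finset.sum_mul, hp]; linarith
  have h2 : ∀ x ∈ Finset.univ, 0 ≤ p x * (f x - r) :=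
    fun x _ => mul_nonneg (hp0 x) (by linarith [hc x])
  have h3 := (Finset.sum_eq_zero_iff_of_nonneg h2).1 (le_antisymm h1 (Finset.sum_nonneg h2))
  have h4 : ∀ x, p x = 0 := fun x => by
    have := h3 x (Finset.mem_univ x)
    rcases mul_eq_zero.1 this with h | h
    · exact h
    · linarith [hc x]
  simp [h4] at hp

theorem sq_sum_mul_le {p f : α → ℝ} (hp0 : ∀ x, 0 ≤ p x) (hp : ∑ x, p x = 1) :
    (∑ x, p x * f x) ^ 2 ≤ ∑ x, p x * f x ^ 2 :=
  Real.pow_arith_mean_le_arith_mean_pow_of_even _ _ _ (fun x _ => hp0 x) hp even_two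
end ProductSums

/-! ### Sums over causally generated sequences -/

section Causal

variable {U : Type*} [Fintype U]

/-- No earlier factor sees the last symbol, so it sums out first, and induction does the rest. No
sign condition on `f` is needed, a freedom that `sum_causal_prod_mul` exploits. -/
theorem sum_causal_prod {n : ℕ} (f : (i : Fin n) → (Fin i → U) → U → ℝ)
    (hf : ∀ i h, ∑ u, f i h u = 1) :
    ∑ u : Fin n → U, ∏ i, f i (fun j => u (Fin.castLE i.isLt.le j)) (u i) = 1 := by
  induction n with
  | zero => simp
  | succ n ih =>
    rw [← (Fin.snocEquiv (fun _ : Fin (n + 1) => U)).sum_comp, Fintype.sum_prod_type_right]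
    simp only [Fin.prod_univ_castSucc, Fin.snocEquiv_apply]
    rw [← ih (fun i => f i.castSucc) (fun i h => hf i.castSucc h)]
    refine Finset.sum_congr rfl fun u _ => ?_
    have h1 : ∀ x : U, ∀ i : Fin n, f i.castSucc
        (fun j => (Fin.snoc u x : Fin (n + 1) → U) (Fin.castLE i.castSucc.isLt.le j))
        ((Fin.snoc u x : Fin (n + 1) → U) i.castSucc)
        = f i.castSucc (fun j => u (Fin.castLE i.isLt.le j)) (u i) := by
      intro x i
      rw [Fin.snoc_castSucc (α := fun _ => U)]
      congr 1
      funext j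
      exact Fin.snoc_castSucc (α := fun _ => U) x u (Fin.castLE i.isLt.le j)
    have h2 : ∀ x : U, f (Fin.last n)
        (fun j => (Fin.snoc u x : Fin (n + 1) → U) (Fin.castLE (Fin.last n).isLt.le j))
        ((Fin.snoc u x : Fin (n + 1) → U) (Fin.last n)) = f (Fin.last n) u x := by
      intro x
      rw [Fin.snoc_last (α := fun _ => U)]
      congr 1
      funext j
      exact Fin.snoc_castSucc (α := fun _ => U) x u j
    simp only [h1, h2, ← Finset.mul_sum]
    rw [hf, mul_one]
    rfl

/-- Replacing a function of the present symbol by its conditional expectation given the past. -/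
theorem sum_causal_prod_mul {n : ℕ} (f : (i : Fin n) → (Fin i → U) → U → ℝ)
    (hf : ∀ i h, ∑ u, f i h u = 1) (k : Fin n) (φ : (Fin k → U) → U → ℝ) :
    ∑ u : Fin n → U, (∏ i, f i (fun j => u (Fin.castLE i.isLt.le j)) (u i)) *
        φ (fun j => u (Fin.castLE k.isLt.le j)) (u k)
      = ∑ u : Fin n → U, (∏ i, f i (fun j => u (Fin.castLE i.isLt.le j)) (u i)) *
        ∑ v, f k (fun j => u (Fin.castLE k.isLt.le j)) v *
          φ (fun j => u (Fin.castLE k.isLt.le j)) v := by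
  -- Multiply the `k`th kernel by `1 + φ - E[φ | past]`. It still sums to one, though it may become
  -- negative, and comparing total masses with and without this factor is the claim.
  set ψ : (i : Fin n) → (Fin i → U) → U → ℝ := fun i h u =>
    if hik : i = k then
      1 + φ (fun j => h (Fin.cast (by rw [hik]) j)) u
        - ∑ v, f i h v * φ (fun j => h (Fin.cast (by rw [hik]) j)) v
    else 1 with hψ
  have hsum : ∀ i h, ∑ u, f i h u * ψ i h u = 1 := by
    intro i h
    by_cases hik : i = k
    · simp only [hψ, hik, dite_true, mul_sub, mul_add, mul_one, Finset.sum_sub_distrib,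
        Finset.sum_add_distrib, hf, ← Finset.sum_mul, one_mul]
      simp
    · simp [hψ, hik, hf]
  have key := sum_causal_prod (fun i h u => f i h u * ψ i h u) hsum
  have hprod : ∀ u : Fin n → U, ∏ i, ψ i (fun j => u (Fin.castLE i.isLt.le j)) (u i)
      = 1 + φ (fun j => u (Fin.castLE k.isLt.le j)) (u k)
        - ∑ v, f k (fun j => u (Fin.castLE k.isLt.le j)) v *
          φ (fun j => u (Fin.castLE k.isLt.le j)) v := by
    intro u
    rw [Finset.prod_eq_single k]
    · simp [hψ]
    · intro i _ hik
      simp [hψ, hik]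
    · simp
  simp only [Finset.prod_mul_distrib, hprod, mul_sub, mul_add, mul_one, Finset.sum_sub_distrib,
    Finset.sum_add_distrib] at key
  rw [sum_causal_prod f hf] at key
  linarith

end Causal

/-! ### The law induced by a code -/

section CodeLaw

variable {X S Y Z Shat : Type*} [Fintype S] [Fintype Y] [Fintype Z]

/-- The joint law of `(S, Y, Z)` given the input. -/
def Channel.kernel (ch : Channel X S Y Z) (x : X) (u : S × Y × Z) : ℝ :=
  ch.stateDist u.1 * ch.law x u.1 u.2

theorem Channel.stateDist_nonneg (ch : Channel X S Y Z) (s : S) : 0 ≤ ch.stateDist s :=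
  ch.stateDist_mem.1 s

theorem Channel.law_nonneg (ch : Channel X S Y Z) (x : X) (s : S) (v : Y × Z) :
    0 ≤ ch.law x s v :=
  (ch.law_mem x s).1 v

theorem Channel.kernel_nonneg (ch : Channel X S Y Z) (x : X) (u : S × Y × Z) :
    0 ≤ ch.kernel x u :=
  mul_nonneg (ch.stateDist_nonneg _) (ch.law_nonneg _ _ _)

theorem Channel.sum_kernel (ch : Channel X S Y Z) (x : X) : ∑ u, ch.kernel x u = 1 := by
  rw [Fintype.sum_prod_type]
  simp only [kernel, ← Finset.mul_sum, (ch.law_mem x _).2, mul_one, ch.stateDist_mem.2]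

variable {M n : ℕ} (C : Code X S Y Z Shat M n) (ch : Channel X S Y Z)

/-- The probability of the path `u` of states and outputs given the message `w`. -/
def Code.pathProb (w : Fin M) (u : Fin n → S × Y × Z) : ℝ :=
  ∏ i, ch.kernel (C.input w (fun j => (u j).2.2) i) (u i)

theorem Code.sum_pathProb (w : Fin M) : ∑ u, C.pathProb ch w u = 1 :=
  sum_causal_prod (U := S × Y × Z)
    (fun i h u => ch.kernel (C.encode i w (fun j => (h j).2.2)) u) (fun _ _ => ch.sum_kernel _)

theorem Code.sum_pathProb_mul (w : Fin M) (i : Fin n) (φ : X → S × Y × Z → ℝ) :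
    ∑ u, C.pathProb ch w u * φ (C.input w (fun j => (u j).2.2) i) (u i)
      = ∑ u, C.pathProb ch w u * ∑ v, ch.kernel (C.input w (fun j => (u j).2.2) i) v *
          φ (C.input w (fun j => (u j).2.2) i) v :=
  sum_causal_prod_mul (U := S × Y × Z)
    (fun i h u => ch.kernel (C.encode i w (fun j => (h j).2.2)) u) (fun _ _ => ch.sum_kernel _) i
    (fun h u => φ (C.encode i w (fun j => (h j).2.2)) u)

theorem sum_triple_eq (n : ℕ) (F : (Fin n → S) → (Fin n → Y) → (Fin n → Z) → ℝ) :
    ∑ s, ∑ y, ∑ z, F s y z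
      = ∑ u : Fin n → S × Y × Z,
          F (fun i => (u i).1) (fun i => (u i).2.1) (fun i => (u i).2.2) := by
  rw [← (Equiv.arrowProdEquivProdArrow (Fin n) (fun _ => S) (fun _ => Y × Z)).symm.sum_comp,
    Fintype.sum_prod_type]
  refine Finset.sum_congr rfl fun s _ => ?_
  rw [← (Equiv.arrowProdEquivProdArrow (Fin n) (fun _ => Y) (fun _ => Z)).symm.sum_comp,
    Fintype.sum_prod_type]
  rfl

theorem Code.expect_eq (f : Fin M → (Fin n → S) → (Fin n → Y) → (Fin n → Z) → ℝ) :
    C.expect ch f = 1 / (M : ℝ) * ∑ w, ∑ u, C.pathProb ch w u *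
      f w (fun i => (u i).1) (fun i => (u i).2.1) (fun i => (u i).2.2) := by
  rw [Code.expect, Finset.mul_sum]
  refine Finset.sum_congr rfl fun w _ => ?_
  rw [sum_triple_eq, Finset.mul_sum]
  refine Finset.sum_congr rfl fun u _ => ?_
  rw [← mul_assoc]
  rfl

theorem Code.jointLaw_nonneg (w : Fin M) (s : Fin n → S) (y : Fin n → Y) (z : Fin n → Z) :
    0 ≤ C.jointLaw ch w s y z :=
  mul_nonneg (by positivity) (Finset.prod_nonneg fun _ _ =>
    mul_nonneg (ch.stateDist_nonneg _) (ch.law_nonneg _ _ _))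

theorem Code.expect_mono {f g : Fin M → (Fin n → S) → (Fin n → Y) → (Fin n → Z) → ℝ}
    (h : ∀ w s y z, f w s y z ≤ g w s y z) : C.expect ch f ≤ C.expect ch g :=
  Finset.sum_le_sum fun w _ => Finset.sum_le_sum fun s _ => Finset.sum_le_sum fun y _ =>
    Finset.sum_le_sum fun z _ => mul_le_mul_of_nonneg_left (h w s y z)
      (C.jointLaw_nonneg ch _ _ _ _)

theorem Code.expect_const (hM : 0 < M) (c : ℝ) : C.expect ch (fun _ _ _ _ => c) = c := by
  rw [C.expect_eq]
  simp only [← Finset.sum_mul, C.sum_pathProb]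
  have : (M : ℝ) ≠ 0 := by positivity
  simp
  field_simp

theorem Code.expect_add (f g : Fin M → (Fin n → S) → (Fin n → Y) → (Fin n → Z) → ℝ) :
    C.expect ch (fun w s y z => f w s y z + g w s y z) = C.expect ch f + C.expect ch g := by
  simp only [Code.expect, mul_add, Finset.sum_add_distrib]

theorem Code.expect_mul_const (f : Fin M → (Fin n → S) → (Fin n → Y) → (Fin n → Z) → ℝ) (c : ℝ) :
    C.expect ch (fun w s y z => f w s y z * c) = C.expect ch f * c := by
  simp only [Code.expect, Finset.sum_mul, mul_assoc]

theorem Code.expect_sum {κ : Type*} (t : Finset κ)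
    (f : κ → Fin M → (Fin n → S) → (Fin n → Y) → (Fin n → Z) → ℝ) :
    C.expect ch (fun w s y z => ∑ k ∈ t, f k w s y z) = ∑ k ∈ t, C.expect ch (f k) := by
  classical
  induction t using Finset.induction_on with
  | empty => simp [Code.expect]
  | insert a t ha ih =>
    simp only [Finset.sum_insert ha, Code.expect_add, ih]

/-- Memorylessness: given the message and the past, the input is fixed and the current triple has
law `kernel`. -/
theorem Code.expect_local (i : Fin n) (φ : X → S × Y × Z → ℝ) :
    C.expect ch (fun w s y z => φ (C.input w z i) (s i, y i, z i))
      = C.expect ch (fun w _ _ z => ∑ v, ch.kernel (C.input w z i) v * φ (C.input w z i) v) := by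
  rw [C.expect_eq, C.expect_eq]
  congr 1
  exact Finset.sum_congr rfl fun w _ => C.sum_pathProb_mul ch w i φ

theorem Channel.sum_kernel_mul_dist (d : S → Shat → ℝ≥0) (e : X → Z → Shat) (x : X) :
    ∑ v, ch.kernel x v * (d v.1 (e x v.2.2) : ℝ) = ch.estCost d e x := by
  rw [Channel.estCost, Fintype.sum_prod_type]
  refine Finset.sum_congr rfl fun s _ => ?_
  rw [Fintype.sum_prod_type, Finset.sum_comm]
  refine Finset.sum_congr rfl fun z _ => ?_
  simp only [Channel.kernel, Channel.lawZ, Finset.sum_mul, Finset.mul_sum]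

theorem Channel.lawZ_nonneg (x : X) (s : S) (z : Z) : 0 ≤ ch.lawZ x s z :=
  Finset.sum_nonneg fun _ _ => ch.law_nonneg _ _ _

theorem Channel.IsOptimalEstimator.unnormalized_le {ch : Channel X S Y Z} {d : S → Shat → ℝ≥0}
    {e : X → Z → Shat} (he : ch.IsOptimalEstimator d e) (x : X) (z : Z) (t : Shat) :
    ∑ s, ch.stateDist s * ch.lawZ x s z * (d s (e x z) : ℝ)
      ≤ ∑ s, ch.stateDist s * ch.lawZ x s z * (d s t : ℝ) := by
  have hnn : ∀ s ∈ Finset.univ, 0 ≤ ch.stateDist s * ch.lawZ x s z :=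
    fun s _ => mul_nonneg (ch.stateDist_nonneg s) (ch.lawZ_nonneg x s z)
  have h := he x z t
  simp only [Channel.posterior, div_mul_eq_mul_div, ← Finset.sum_div] at h
  rcases (Finset.sum_nonneg hnn).eq_or_lt with h0 | h0
  -- Where `z` has probability zero given `x`, all weights vanish and both sides are zero.
  · have h1 := (Finset.sum_eq_zero_iff_of_nonneg hnn).1 h0.symm
    rw [Finset.sum_eq_zero (fun s hs => by rw [h1 s hs, zero_mul]),
      Finset.sum_eq_zero (fun s hs => by rw [h1 s hs, zero_mul])]
  · exact (div_le_div_iff_of_pos_right h0).1 h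

theorem Code.distortion_le (hM : 0 < M) {d : S → Shat → ℝ≥0} {K : ℝ} (hK0 : 0 ≤ K)
    (hK : ∀ s t, (d s t : ℝ) ≤ K) : C.distortion ch d ≤ K := by
  have h : ∀ i, C.expect ch (fun w s _ z => (d (s i) (C.estimate (C.input w z) z i) : ℝ)) ≤ K :=
    fun i => (C.expect_mono ch fun w s y z => hK _ _).trans_eq (C.expect_const ch hM K)
  rcases Nat.eq_zero_or_pos n with rfl | hn
  · simpa [Code.distortion] using hK0
  · have hn' : (0 : ℝ) < n := by exact_mod_cast hn
    calc C.distortion ch d ≤ 1 / (n : ℝ) * ∑ _i : Fin n, K :=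
          mul_le_mul_of_nonneg_left (Finset.sum_le_sum fun i _ => h i) (by positivity)
      _ = K := by simp; field_simp

open Classical in
/-- The time-averaged input distribution of a code. -/
def Code.inputDist (x : X) : ℝ :=
  (1 / (n : ℝ)) * ∑ i, C.expect ch (fun w _ _ z => if C.input w z i = x then 1 else 0)

theorem Code.inputDist_nonneg (x : X) : 0 ≤ C.inputDist ch x := by
  classical
  refine mul_nonneg (by positivity) (Finset.sum_nonneg fun i _ => ?_)
  refine Finset.sum_nonneg fun w _ => Finset.sum_nonneg fun s _ => Finset.sum_nonneg fun y _ =>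
    Finset.sum_nonneg fun z _ => mul_nonneg (C.jointLaw_nonneg ch _ _ _ _) ?_
  dsimp only
  split_ifs <;> norm_num

variable [Fintype X]

/-- Per-letter averages see the code only through its averaged input law; this is what
single-letterizes the converse. -/
theorem Code.sum_inputDist_mul (g : X → ℝ) :
    ∑ x, C.inputDist ch x * g x
      = (1 / (n : ℝ)) * ∑ i, C.expect ch (fun w _ _ z => g (C.input w z i)) := by
  classical
  simp only [Code.inputDist, mul_assoc, ← Finset.mul_sum, Finset.sum_mul,
    ← Code.expect_mul_const]
  rw [Finset.sum_comm]
  simp only [← Code.expect_sum]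
  simp

theorem Code.inputDist_mem (hM : 0 < M) (hn : 0 < n) : C.inputDist ch ∈ stdSimplex ℝ X := by
  refine ⟨C.inputDist_nonneg ch, ?_⟩
  have h := C.sum_inputDist_mul ch (fun _ => 1)
  have hn' : (n : ℝ) ≠ 0 := by positivity
  simp only [mul_one, C.expect_const ch hM] at h
  rw [h]
  simp [hn']

theorem Code.sum_inputDist_mul_cost (b : X → ℝ≥0) :
    ∑ x, C.inputDist ch x * (b x : ℝ) = C.cost ch b :=
  C.sum_inputDist_mul ch _

theorem Code.sum_inputDist_mul_estCost (d : S → Shat → ℝ≥0) (e : X → Z → Shat) :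
    ∑ x, C.inputDist ch x * ch.estCost d e x
      = (1 / (n : ℝ)) * ∑ i, C.expect ch
          (fun w s _ z => (d (s i) (e (C.input w z i) (z i)) : ℝ)) := by
  rw [C.sum_inputDist_mul ch]
  congr 1
  refine Finset.sum_congr rfl fun i _ => ?_
  rw [C.expect_local ch i (fun x v => (d v.1 (e x v.2.2) : ℝ))]
  simp only [Channel.sum_kernel_mul_dist]

/-- Fixing the message and `z` fixes all inputs and the estimate. Up to a factor free of `s i`, the
weight of `s i` is then its unnormalized posterior given the `i`th input and `z i`, so
`unnormalized_le` applies term by term. -/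
theorem Code.sum_inputDist_mul_estCost_le {d : S → Shat → ℝ≥0} {e : X → Z → Shat}
    (he : ch.IsOptimalEstimator d e) :
    ∑ x, C.inputDist ch x * ch.estCost d e x ≤ C.distortion ch d := by
  rw [C.sum_inputDist_mul_estCost ch, Code.distortion]
  refine mul_le_mul_of_nonneg_left (Finset.sum_le_sum fun i _ => ?_) (by positivity)
  have hrw : ∀ f : Fin M → (Fin n → Z) → S → ℝ, C.expect ch (fun w s _ z => f w z (s i))
      = ∑ w, ∑ z, 1 / (M : ℝ) * ((∏ j ∈ Finset.univ.erase i, ∑ v : S × Y,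
          ch.stateDist v.1 * ch.law (C.input w z j) v.1 (v.2, z j)) *
        ∑ s, ch.stateDist s * ch.lawZ (C.input w z i) s (z i) * f w z s) := by
    intro f
    refine Finset.sum_congr rfl fun w _ => ?_
    have hsw : ∀ F : (Fin n → S) → (Fin n → Y) → (Fin n → Z) → ℝ,
        ∑ s, ∑ y, ∑ z, F s y z = ∑ z, ∑ s, ∑ y, F s y z := by
      intro F
      exact (Finset.sum_congr rfl fun s _ => Finset.sum_comm).trans Finset.sum_comm
    rw [hsw]
    refine Finset.sum_congr rfl fun z _ => ?_
    have h1 := sum_prod_mul_coord (ι := Fin n)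
      (fun j (v : S × Y) => ch.stateDist v.1 * ch.law (C.input w z j) v.1 (v.2, z j)) i
      (fun v => f w z v.1)
    rw [Fintype.sum_prod_type (f := fun v : S × Y => ch.stateDist v.1 *
      ch.law (C.input w z i) v.1 (v.2, z i) * f w z v.1)] at h1
    simp only [Channel.lawZ, Finset.mul_sum (s := (Finset.univ : Finset Y)), Finset.sum_mul]
    rw [← h1, ← (Equiv.arrowProdEquivProdArrow (Fin n) (fun _ => S) (fun _ => Y)).symm.sum_comp,
      Fintype.sum_prod_type, Finset.mul_sum]
    refine Finset.sum_congr rfl fun s _ => ?_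
    rw [Finset.mul_sum]
    refine Finset.sum_congr rfl fun y _ => ?_
    simp only [Code.jointLaw, mul_assoc]
    rfl
  rw [hrw (fun w z s => (d s (e (C.input w z i) (z i)) : ℝ)),
    hrw (fun w z s => (d s (C.estimate (C.input w z) z i) : ℝ))]
  refine Finset.sum_le_sum fun w _ => Finset.sum_le_sum fun z _ => ?_
  refine mul_le_mul_of_nonneg_left (mul_le_mul_of_nonneg_left (he.unnormalized_le _ _ _) ?_)
    (by positivity)
  exact Finset.prod_nonneg fun j _ => Finset.sum_nonneg fun v _ =>
    mul_nonneg (ch.stateDist_nonneg _) (ch.law_nonneg _ _ _)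

end CodeLaw

/-! ### The information quantity -/

section Info

variable {X S Y Z : Type*} [Fintype S] [Fintype Y] [Fintype Z] (ch : Channel X S Y Z)

/-- The marginal `P_{Y|SX}(y|s,x)`. -/
def Channel.lawY (x : X) (s : S) (y : Y) : ℝ := ∑ z, ch.law x s (y, z)

theorem Channel.lawY_nonneg (x : X) (s : S) (y : Y) : 0 ≤ ch.lawY x s y :=
  Finset.sum_nonneg fun _ _ => ch.law_nonneg _ _ _

theorem Channel.sum_lawY (x : X) (s : S) : ∑ y, ch.lawY x s y = 1 := by
  rw [← (ch.law_mem x s).2, Fintype.sum_prod_type]; rfl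

theorem Channel.sum_lawZ (x : X) (s : S) : ∑ z, ch.lawZ x s z = 1 := by
  rw [← (ch.law_mem x s).2, Fintype.sum_prod_type, Finset.sum_comm]; rfl

theorem Channel.law_le_lawY (x : X) (s : S) (y : Y) (z : Z) : ch.law x s (y, z) ≤ ch.lawY x s y :=
  Finset.single_le_sum (f := fun z => ch.law x s (y, z)) (fun _ _ => ch.law_nonneg _ _ _)
    (Finset.mem_univ z)

variable [Fintype X]

/-- The law `P_{Y|S}` of the output given the state under the input distribution `P`. -/
def Channel.outY (P : X → ℝ) (s : S) (y : Y) : ℝ := ∑ x, P x * ch.lawY x s y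

/-- The information density of the channel with state known at the receiver, in nats. -/
def Channel.infoDensity (P : X → ℝ) (x : X) (s : S) (y : Y) : ℝ :=
  Real.log (ch.lawY x s y / ch.outY P s y)

variable {P : X → ℝ}

theorem Channel.outY_nonneg (hP : P ∈ stdSimplex ℝ X) (s : S) (y : Y) : 0 ≤ ch.outY P s y :=
  Finset.sum_nonneg fun x _ => mul_nonneg (hP.1 x) (ch.lawY_nonneg x s y)

theorem Channel.sum_outY (hP : P ∈ stdSimplex ℝ X) (s : S) : ∑ y, ch.outY P s y = 1 := by
  simp only [Channel.outY]
  rw [Finset.sum_comm]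
  simp only [← Finset.mul_sum, ch.sum_lawY, mul_one, hP.2]

theorem Channel.mul_lawY_le_outY (hP : P ∈ stdSimplex ℝ X) (x : X) (s : S) (y : Y) :
    P x * ch.lawY x s y ≤ ch.outY P s y :=
  Finset.single_le_sum (f := fun x => P x * ch.lawY x s y)
    (fun x _ => mul_nonneg (hP.1 x) (ch.lawY_nonneg x s y)) (Finset.mem_univ x)

/-- The factor `log 2` converts bits to nats. Cells of zero weight absorb whatever value the
logarithm takes there. -/
theorem Channel.info_mul_log_two (hP : P ∈ stdSimplex ℝ X) :
    ch.info P * Real.log 2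
      = ∑ x, ∑ s, ∑ y, P x * ch.stateDist s * ch.lawY x s y * ch.infoDensity P x s y := by
  have hp : ∀ x s y, ∑ z, P x * ch.stateDist s * ch.law x s (y, z)
      = P x * ch.stateDist s * ch.lawY x s y := fun x s y => by
    rw [Channel.lawY, Finset.mul_sum]
  have h2 : Real.log 2 ≠ 0 := (Real.log_pos one_lt_two).ne'
  simp only [Channel.info, condMutualInfo, hp, Finset.sum_mul]
  refine Finset.sum_congr rfl fun x _ => Finset.sum_congr rfl fun s _ =>
    Finset.sum_congr rfl fun y _ => ?_
  have hX : ∑ x', P x' * ch.stateDist s * ch.lawY x' s y = ch.stateDist s * ch.outY P s y := by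
    rw [Channel.outY, Finset.mul_sum]
    exact Finset.sum_congr rfl fun _ _ => by ring
  simp only [← Finset.mul_sum, ch.sum_lawY, mul_one, ← Finset.sum_mul, hP.2, one_mul, hX]
  by_cases h0 : P x * ch.stateDist s * ch.lawY x s y = 0
  · simp [h0]
  · have hPx : P x ≠ 0 := fun h => h0 (by simp [h])
    have hs : ch.stateDist s ≠ 0 := fun h => h0 (by simp [h])
    rw [Channel.infoDensity, mul_assoc, Real.logb, div_mul_cancel₀ _ h2]
    congr 2
    rw [show ch.stateDist s * (P x * ch.stateDist s * ch.lawY x s y)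
      = (P x * ch.stateDist s * ch.stateDist s) * ch.lawY x s y by ring,
      show P x * ch.stateDist s * (ch.stateDist s * ch.outY P s y)
      = (P x * ch.stateDist s * ch.stateDist s) * ch.outY P s y by ring]
    exact mul_div_mul_left _ _ (mul_ne_zero (mul_ne_zero hPx hs) hs)

theorem Channel.info_mul_log_two_eq_sum_kernel (hP : P ∈ stdSimplex ℝ X) :
    ch.info P * Real.log 2
      = ∑ x, P x * ∑ v, ch.kernel x v * ch.infoDensity P x v.1 v.2.1 := by
  rw [ch.info_mul_log_two hP]
  refine Finset.sum_congr rfl fun x _ => ?_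
  rw [Fintype.sum_prod_type, Finset.mul_sum]
  refine Finset.sum_congr rfl fun s _ => ?_
  rw [Fintype.sum_prod_type, Finset.mul_sum]
  refine Finset.sum_congr rfl fun y _ => ?_
  simp only [Channel.kernel, Channel.lawY, Finset.mul_sum, Finset.sum_mul]
  exact Finset.sum_congr rfl fun z _ => by ring

/-- Writing the information as `H(Y|S) - H(Y|S,X)` removes the singular quotients: `Real.negMulLog`
is continuous at zero as well. -/
theorem Channel.info_mul_log_two_eq_negMulLog (hP : P ∈ stdSimplex ℝ X) :
    ch.info P * Real.log 2
      = ∑ s, ∑ y, ch.stateDist s * Real.negMulLog (ch.outY P s y)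
        - ∑ x, P x * ∑ s, ∑ y, ch.stateDist s * Real.negMulLog (ch.lawY x s y) := by
  have h1 : ∑ s, ∑ y, ch.stateDist s * Real.negMulLog (ch.outY P s y)
      = ∑ x, ∑ s, ∑ y, -(P x * ch.stateDist s * ch.lawY x s y * Real.log (ch.outY P s y)) := by
    refine Eq.trans ?_ (Finset.sum_comm.trans
      (Finset.sum_congr rfl fun s _ => Finset.sum_comm)).symm
    refine Finset.sum_congr rfl fun s _ => Finset.sum_congr rfl fun y _ => ?_
    rw [Real.negMulLog]
    conv_lhs => rw [Channel.outY]
    rw [← Finset.sum_neg_distrib, Finset.sum_mul, Finset.mul_sum]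
    exact Finset.sum_congr rfl fun x _ => by rw [← Channel.outY]; ring
  rw [ch.info_mul_log_two hP, h1, ← Finset.sum_sub_distrib]
  refine Finset.sum_congr rfl fun x _ => ?_
  rw [Finset.mul_sum, ← Finset.sum_sub_distrib]
  refine Finset.sum_congr rfl fun s _ => ?_
  rw [Finset.mul_sum, ← Finset.sum_sub_distrib]
  refine Finset.sum_congr rfl fun y _ => ?_
  by_cases h0 : P x * ch.lawY x s y = 0
  · rcases mul_eq_zero.1 h0 with h | h <;> simp [h]
  · have hpos : 0 < P x * ch.lawY x s y :=
      lt_of_le_of_ne (mul_nonneg (hP.1 x) (ch.lawY_nonneg x s y)) (Ne.symm h0)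
    rw [Channel.infoDensity, Real.log_div (right_ne_zero_of_mul h0)
      (hpos.trans_le (ch.mul_lawY_le_outY hP x s y)).ne', Real.negMulLog]
    ring

theorem Channel.continuousOn_info : ContinuousOn ch.info (stdSimplex ℝ X) := by
  have h2 : Real.log 2 ≠ 0 := (Real.log_pos one_lt_two).ne'
  have hc : Continuous fun P : X → ℝ =>
      (∑ s, ∑ y, ch.stateDist s * Real.negMulLog (ch.outY P s y)
        - ∑ x, P x * ∑ s, ∑ y, ch.stateDist s * Real.negMulLog (ch.lawY x s y))
        / Real.log 2 := by
    unfold Channel.outY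
    have := Real.continuous_negMulLog
    fun_prop
  refine hc.continuousOn.congr fun P hP => ?_
  simp only
  rw [← ch.info_mul_log_two_eq_negMulLog hP, mul_div_cancel_right₀ _ h2]

end Info

/-! ### The converse -/

section Converse

variable {X S Y Z Shat : Type*} [Fintype S] [Fintype Y] [Fintype Z] (ch : Channel X S Y Z)

open Classical in
/-- The conditional law `P_{Z|SXY}`, completed by `P_{Z|SX}` where it is undefined. -/
def Channel.condZ (x : X) (s : S) (y : Y) (z : Z) : ℝ :=
  if ch.lawY x s y = 0 then ch.lawZ x s z else ch.law x s (y, z) / ch.lawY x s y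

theorem Channel.condZ_nonneg (x : X) (s : S) (y : Y) (z : Z) : 0 ≤ ch.condZ x s y z := by
  unfold Channel.condZ
  split_ifs
  · exact ch.lawZ_nonneg _ _ _
  · exact div_nonneg (ch.law_nonneg _ _ _) (ch.lawY_nonneg _ _ _)

theorem Channel.sum_condZ (x : X) (s : S) (y : Y) : ∑ z, ch.condZ x s y z = 1 := by
  unfold Channel.condZ
  split_ifs with h
  · exact ch.sum_lawZ x s
  · rw [← Finset.sum_div]
    exact div_self h

variable {M n : ℕ} (C : Code X S Y Z Shat M n)

/-- Once message, states and outputs `y` are frozen, the feedback is still generated causally. This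
is where it drops out of the converse. -/
theorem Code.sum_prod_condZ (w : Fin M) (s : Fin n → S) (y : Fin n → Y) :
    ∑ z : Fin n → Z, ∏ i, ch.condZ (C.input w z i) (s i) (y i) (z i) = 1 :=
  sum_causal_prod (fun i h z => ch.condZ (C.encode i w h) (s i) (y i) z)
    (fun _ _ => ch.sum_condZ _ _ _)

theorem Code.inputDist_pos_of_jointLaw_ne_zero {w : Fin M} {s : Fin n → S} {y : Fin n → Y}
    {z : Fin n → Z} (h : C.jointLaw ch w s y z ≠ 0) (i : Fin n) :
    0 < C.inputDist ch (C.input w z i) := by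
  classical
  have hn : (0 : ℝ) < n := by exact_mod_cast i.pos
  have hE : ∀ (x : X) (j : Fin n), 0 ≤ C.expect ch
      (fun w _ _ z => if C.input w z j = x then (1 : ℝ) else 0) := by
    intro x j
    refine Finset.sum_nonneg fun w _ => Finset.sum_nonneg fun s _ => Finset.sum_nonneg fun y _ =>
      Finset.sum_nonneg fun z _ => mul_nonneg (C.jointLaw_nonneg ch _ _ _ _) ?_
    dsimp only
    split_ifs <;> norm_num
  refine mul_pos (by positivity) (Finset.sum_pos' (fun j _ => hE _ j) ⟨i, Finset.mem_univ i, ?_⟩)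
  have hnn : ∀ w' s' y' z', 0 ≤ C.jointLaw ch w' s' y' z' *
      (if C.input w' z' i = C.input w z i then (1 : ℝ) else 0) := by
    intro w' s' y' z'
    refine mul_nonneg (C.jointLaw_nonneg ch _ _ _ _) ?_
    split_ifs <;> norm_num
  refine Finset.sum_pos' (fun _ _ => Finset.sum_nonneg fun _ _ => Finset.sum_nonneg fun _ _ =>
    Finset.sum_nonneg fun _ _ => hnn _ _ _ _) ⟨w, Finset.mem_univ _, ?_⟩
  refine Finset.sum_pos' (fun _ _ => Finset.sum_nonneg fun _ _ =>
    Finset.sum_nonneg fun _ _ => hnn _ _ _ _) ⟨s, Finset.mem_univ _, ?_⟩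
  refine Finset.sum_pos' (fun _ _ => Finset.sum_nonneg fun _ _ => hnn _ _ _ _)
    ⟨y, Finset.mem_univ _, ?_⟩
  refine Finset.sum_pos' (fun _ _ => hnn _ _ _ _) ⟨z, Finset.mem_univ _, ?_⟩
  simpa using lt_of_le_of_ne (C.jointLaw_nonneg ch w s y z) (Ne.symm h)

variable [Fintype X]

theorem Channel.sum_prod_outY {P : X → ℝ} (hP : P ∈ stdSimplex ℝ X) :
    ∑ s : Fin n → S, ∑ y : Fin n → Y, ∏ i, (ch.stateDist (s i) * ch.outY P (s i) (y i)) = 1 := by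
  rw [← sum_iid (ι := Fin n) ch.stateDist_mem.2]
  refine Finset.sum_congr rfl fun s _ => ?_
  rw [sum_prod_eq_prod_sum (fun i y => ch.stateDist (s i) * ch.outY P (s i) y)]
  simp only [← Finset.mul_sum, ch.sum_outY hP, mul_one]

/-- The change of measure. On the support of the joint law all logarithms have positive arguments
and equality holds; off it the left side is zero. -/
theorem Code.jointLaw_mul_exp_le (hM : 0 < M) (hn : 0 < n) (w : Fin M) (s : Fin n → S)
    (y : Fin n → Y) (z : Fin n → Z) :
    C.jointLaw ch w s y z *
        Real.exp (-∑ i, ch.infoDensity (C.inputDist ch) (C.input w z i) (s i) (y i))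
      ≤ 1 / (M : ℝ) * (∏ i, (ch.stateDist (s i) * ch.outY (C.inputDist ch) (s i) (y i))) *
        ∏ i, ch.condZ (C.input w z i) (s i) (y i) (z i) := by
  have hP := C.inputDist_mem ch hM hn
  by_cases h0 : C.jointLaw ch w s y z = 0
  · rw [h0, zero_mul]
    exact mul_nonneg (mul_nonneg (by positivity) (Finset.prod_nonneg fun i _ =>
      mul_nonneg (ch.stateDist_nonneg _) (ch.outY_nonneg hP _ _)))
      (Finset.prod_nonneg fun i _ => ch.condZ_nonneg _ _ _ _)
  · refine le_of_eq ?_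
    rw [Code.jointLaw, ← Finset.sum_neg_distrib, Real.exp_sum, mul_assoc, mul_assoc,
      ← Finset.prod_mul_distrib, ← Finset.prod_mul_distrib]
    congr 1
    refine Finset.prod_congr rfl fun i _ => ?_
    have hfac := Finset.prod_ne_zero_iff.1 (right_ne_zero_of_mul h0) i (Finset.mem_univ i)
    have hlaw : 0 < ch.law (C.input w z i) (s i) (y i, z i) :=
      lt_of_le_of_ne (ch.law_nonneg _ _ _) (right_ne_zero_of_mul hfac).symm
    have hY := hlaw.trans_le (ch.law_le_lawY _ _ _ _)
    have hq := (mul_pos (C.inputDist_pos_of_jointLaw_ne_zero ch h0 i) hY).trans_le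
      (ch.mul_lawY_le_outY hP _ _ _)
    rw [Channel.infoDensity, Real.exp_neg, Real.exp_log (div_pos hY hq), Channel.condZ,
      if_neg hY.ne', inv_div]
    field_simp

theorem Code.one_sub_errorProb_mul_log_le (hM : 0 < M) (hn : 0 < n) :
    (1 - C.errorProb ch) * Real.log M
      ≤ n * (ch.info (C.inputDist ch) * Real.log 2) + Real.log 2 := by
  classical
  have hP := C.inputDist_mem ch hM hn
  have hM' : (0 : ℝ) < M := by exact_mod_cast hM
  have hn' : (n : ℝ) ≠ 0 := by positivity
  set L : Fin M → (Fin n → S) → (Fin n → Y) → (Fin n → Z) → ℝ := fun w s y z =>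
    ∑ i, ch.infoDensity (C.inputDist ch) (C.input w z i) (s i) (y i) with hL
  set F : Fin M → (Fin n → S) → (Fin n → Y) → (Fin n → Z) → ℝ := fun w s y _ =>
    if C.decode s y ≠ w then 1 else 0 with hF
  -- Equality holds because the density refers to the output law of the averaged input; concavity of
  -- the information is not needed.
  have hEL : C.expect ch L = n * (ch.info (C.inputDist ch) * Real.log 2) := by
    rw [ch.info_mul_log_two_eq_sum_kernel hP, C.sum_inputDist_mul ch, ← mul_assoc,
      mul_one_div_cancel hn', one_mul, hL, C.expect_sum]
    exact Finset.sum_congr rfl fun i _ => C.expect_local ch i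
      (fun x v => ch.infoDensity (C.inputDist ch) x v.1 v.2.1)
  -- This is `t + 1 ≤ exp t`, at `t = log M - log 2 - L` for a correct decision and `t = -L - log 2`
  -- for a wrong one. The last factor is chosen to have mean one when `W` is uniform and independent
  -- of the decision, which is then correct with probability `1 / M`.
  have hpt : ∀ w s y z, (1 - Real.log 2 + Real.log M) + F w s y z * (-Real.log M)
      + L w s y z * (-1) ≤ Real.exp (-L w s y z) * ((1 + M * (1 - F w s y z)) / 2) := by
    intro w s y z
    by_cases hd : C.decode s y = w
    · have h := Real.add_one_le_exp (-L w s y z + Real.log M - Real.log 2)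
      rw [Real.exp_sub, Real.exp_add, Real.exp_log hM', Real.exp_log two_pos] at h
      have := Real.exp_pos (-L w s y z)
      simp only [hF, hd, ne_eq, not_true_eq_false, if_false]
      linarith
    · have h := Real.add_one_le_exp (-L w s y z - Real.log 2)
      rw [Real.exp_sub, Real.exp_log two_pos] at h
      simp only [hF, hd, ne_eq, not_false_eq_true, if_true]
      linarith
  have h1 := C.expect_mono ch hpt
  rw [C.expect_add, C.expect_add, C.expect_const ch hM, C.expect_mul_const, C.expect_mul_const,
    hEL] at h1
  have h2 : C.expect ch (fun w s y z => Real.exp (-L w s y z) * ((1 + M * (1 - F w s y z)) / 2))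
      ≤ 1 := by
    calc _ ≤ ∑ w, ∑ s, ∑ y, ∑ z : Fin n → Z, (1 / (M : ℝ) *
            (∏ i, (ch.stateDist (s i) * ch.outY (C.inputDist ch) (s i) (y i))) *
            ∏ i, ch.condZ (C.input w z i) (s i) (y i) (z i)) *
            ((1 + M * (if C.decode s y = w then 1 else 0)) / 2) := by
          refine Finset.sum_le_sum fun w _ => Finset.sum_le_sum fun s _ =>
            Finset.sum_le_sum fun y _ => Finset.sum_le_sum fun z _ => ?_
          have hif : 1 - F w s y z = if C.decode s y = w then 1 else 0 := by
            by_cases hd : C.decode s y = w <;> simp [hF, hd]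
          rw [← mul_assoc, hif]
          refine mul_le_mul_of_nonneg_right (C.jointLaw_mul_exp_le ch hM hn w s y z) ?_
          split_ifs <;> positivity
      _ = ∑ w, ∑ s, ∑ y, 1 / (M : ℝ) *
            (∏ i, (ch.stateDist (s i) * ch.outY (C.inputDist ch) (s i) (y i))) *
            ((1 + M * (if C.decode s y = w then 1 else 0)) / 2) := by
          refine Finset.sum_congr rfl fun w _ => Finset.sum_congr rfl fun s _ =>
            Finset.sum_congr rfl fun y _ => ?_
          rw [← Finset.sum_mul, ← Finset.mul_sum, C.sum_prod_condZ, mul_one]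
      _ = ∑ s : Fin n → S, ∑ y : Fin n → Y,
            ∏ i, (ch.stateDist (s i) * ch.outY (C.inputDist ch) (s i) (y i)) := by
          rw [Finset.sum_comm]
          refine Finset.sum_congr rfl fun s _ => ?_
          rw [Finset.sum_comm]
          refine Finset.sum_congr rfl fun y _ => ?_
          rw [← Finset.mul_sum, ← Finset.sum_div, Finset.sum_add_distrib, ← Finset.mul_sum,
            Finset.sum_ite_eq]
          simp
          field_simp
      _ = 1 := ch.sum_prod_outY hP
      _ ≤ 1 := le_rfl
  have h3 : C.errorProb ch = C.expect ch F := rfl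
  rw [h3]
  linarith

end Converse

/-! ### Passage to the limit in the converse -/

section ConverseLimit

open Filter Topology

/-- The bound `K` ensures that the real `limsup` is genuine and not a default value. -/
theorem le_of_limsup_le_of_tendsto {u v : ℕ → ℝ} {ψ : ℕ → ℕ} {l a K : ℝ}
    (hu : ∀ᶠ n in atTop, u n ≤ K) (hlim : limsup u atTop ≤ a) (hψ : Tendsto ψ atTop atTop)
    (hvu : ∀ k, v k ≤ u (ψ k)) (hv : Tendsto v atTop (𝓝 l)) : l ≤ a := by
  refine le_of_forall_pos_le_add fun ε hε => ?_
  have h1 : ∀ᶠ n in atTop, u n < a + ε :=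
    eventually_lt_of_limsup_lt (lt_of_le_of_lt hlim (by linarith)) ⟨K, by simpa using hu⟩
  refine le_of_tendsto hv ?_
  filter_upwards [hψ.eventually h1] with k hk
  exact (hvu k).trans hk.le

variable {X S Y Z Shat : Type*} [Fintype S] [Fintype Y] [Fintype Z]

theorem Code.errorProb_le_one {M n : ℕ} (C : Code X S Y Z Shat M n) (ch : Channel X S Y Z)
    (hM : 0 < M) : C.errorProb ch ≤ 1 := by
  refine (C.expect_mono ch fun w s y z => ?_).trans_eq (C.expect_const ch hM 1)
  split_ifs <;> norm_num

variable [Fintype X]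
  {ch : Channel X S Y Z} {d : S → Shat → ℝ≥0} {b : X → ℝ≥0}

/-- Every achievable rate is bounded by the information of some feasible input distribution. -/
theorem Achievable.exists_le_info [Finite Shat] {e : X → Z → Shat}
    (he : ch.IsOptimalEstimator d e) {R D B : ℝ} (h : Achievable ch d b R D B) :
    ∃ P ∈ distortionSet (ch.estCost d e) D ∩ costSet b B, R ≤ ch.info P := by
  obtain ⟨hR, M, C, hM, herr, hdist, hcost⟩ := h
  have hMpos : ∀ n, 0 < M n := fun n => by
    have := (Real.rpow_pos_of_pos two_pos ((n : ℝ) * R)).trans_le (hM n)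
    exact_mod_cast this
  -- Lengths start at one: at length zero `inputDist` is identically zero and not a pmf.
  have hmem : ∀ k, (C (k + 1)).inputDist ch ∈ stdSimplex ℝ X :=
    fun k => (C (k + 1)).inputDist_mem ch (hMpos _) k.succ_pos
  obtain ⟨P, hP, φ, hφ, hlim⟩ := (isCompact_stdSimplex ℝ X).tendsto_subseq hmem
  have hψ : Tendsto (fun k => φ k + 1) atTop atTop :=
    (tendsto_add_atTop_nat 1).comp hφ.tendsto_atTop
  have hlin : ∀ g : X → ℝ, Tendsto (fun k => ∑ x, (C (φ k + 1)).inputDist ch x * g x) atTop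
      (𝓝 (∑ x, P x * g x)) := fun g =>
    tendsto_finsetSum _ fun x _ => ((tendsto_pi_nhds.1 hlim x).mul_const _)
  have hbdd : ∃ K : ℝ, 0 ≤ K ∧ ∀ s t, (d s t : ℝ) ≤ K := by
    obtain ⟨K, hK⟩ := (Set.finite_range fun p : S × Shat => d p.1 p.2).bddAbove
    exact ⟨K, K.2, fun s t => NNReal.coe_le_coe.2 (hK ⟨(s, t), rfl⟩)⟩
  obtain ⟨K, hK0, hK⟩ := hbdd
  refine ⟨P, ⟨⟨hP, ?_⟩, ⟨hP, ?_⟩⟩, ?_⟩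
  · exact le_of_limsup_le_of_tendsto
      (Eventually.of_forall fun n => (C n).distortion_le ch (hMpos n) hK0 hK) hdist hψ
      (fun k => (C (φ k + 1)).sum_inputDist_mul_estCost_le ch he) (hlin _)
  · refine le_of_limsup_le_of_tendsto (K := ∑ x, (b x : ℝ)) ?_ hcost hψ
      (fun k => ((C (φ k + 1)).sum_inputDist_mul_cost ch b).le) (hlin _)
    filter_upwards [eventually_gt_atTop 0] with n hn
    have hm := (C n).inputDist_mem ch (hMpos n) hn
    rw [← Code.sum_inputDist_mul_cost]
    exact Finset.sum_le_sum fun x _ => mul_le_of_le_one_left (NNReal.coe_nonneg _)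
      (by simpa using (mem_Icc_of_mem_stdSimplex hm x).2)
  · have hlog2 : 0 < Real.log 2 := Real.log_pos one_lt_two
    have hineq : ∀ k, (1 - (C (φ k + 1)).errorProb ch) * R
        ≤ ch.info ((C (φ k + 1)).inputDist ch) + 1 / ((φ k + 1 : ℕ) : ℝ) := by
      intro k
      set n := φ k + 1 with hn
      have hnpos : (0 : ℝ) < n := by rw [hn]; positivity
      have h1 := (C n).one_sub_errorProb_mul_log_le ch (hMpos n) (Nat.succ_pos _)
      have h2 : (n : ℝ) * R * Real.log 2 ≤ Real.log (M n) := by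
        rw [← Real.log_rpow two_pos]
        exact Real.log_le_log (by positivity) (hM n)
      have h3 : 0 ≤ 1 - (C n).errorProb ch :=
        sub_nonneg.2 ((C n).errorProb_le_one ch (hMpos n))
      have h4 := (mul_le_mul_of_nonneg_left h2 h3).trans h1
      have h5 : (n : ℝ) * Real.log 2 * ((1 - (C n).errorProb ch) * R)
          ≤ n * Real.log 2 * (ch.info ((C n).inputDist ch) + 1 / (n : ℝ)) := by
        have : (n : ℝ) * Real.log 2 * (1 / (n : ℝ)) = Real.log 2 := by field_simp
        rw [mul_add, this]
        linarith
      exact le_of_mul_le_mul_left h5 (by positivity)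
    have hl : Tendsto (fun k => (1 - (C (φ k + 1)).errorProb ch) * R) atTop (𝓝 ((1 - 0) * R)) :=
      ((tendsto_const_nhds).sub (herr.comp hψ)).mul_const R
    have hinfo : Tendsto (fun k => ch.info ((C (φ k + 1)).inputDist ch)) atTop (𝓝 (ch.info P)) :=
      (ch.continuousOn_info P hP).tendsto.comp
        (tendsto_nhdsWithin_iff.2 ⟨hlim, Eventually.of_forall fun k => hmem _⟩)
    have hr := hinfo.add ((tendsto_one_div_atTop_nhds_zero_nat (𝕜 := ℝ)).comp hψ)
    simpa using le_of_tendsto_of_tendsto' hl hr hineq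

end ConverseLimit

/-! ### Existence of the maximizer -/

section Maximizer

variable {X S Y Z : Type*} [Fintype X] [Fintype S] [Fintype Y] [Fintype Z]

theorem isCompact_setOf_sum_mul_le (g : X → ℝ) (a : ℝ) :
    IsCompact {P : X → ℝ | P ∈ stdSimplex ℝ X ∧ ∑ x, P x * g x ≤ a} :=
  (isCompact_stdSimplex ℝ X).inter_right
    (isClosed_le (by fun_prop : Continuous fun P : X → ℝ => ∑ x, P x * g x) continuous_const)

/-- By compactness the infimum defining `minDistortion` is attained, so `D` equal to it is allowed.
-/
theorem distortionSet_inter_costSet_nonempty {c : X → ℝ} {b : X → ℝ≥0} {D B : ℝ}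
    (hfeas : (costSet b B).Nonempty) (hD : minDistortion c b B ≤ D) :
    (distortionSet c D ∩ costSet b B).Nonempty := by
  have hK : IsCompact (costSet b B) := isCompact_setOf_sum_mul_le (fun x => (b x : ℝ)) B
  obtain ⟨P, hP, hmin⟩ := hK.exists_sInf_image_eq hfeas
    (by fun_prop : Continuous fun P : X → ℝ => ∑ x, P x * c x).continuousOn
  exact ⟨P, ⟨hP.1, hmin.symm.le.trans hD⟩, hP⟩

theorem Channel.exists_isMaxOn_info (ch : Channel X S Y Z) {c : X → ℝ} {b : X → ℝ≥0} {D B : ℝ}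
    (hne : (distortionSet c D ∩ costSet b B).Nonempty) :
    ∃ P ∈ distortionSet c D ∩ costSet b B, IsMaxOn ch.info (distortionSet c D ∩ costSet b B) P :=
  ((isCompact_setOf_sum_mul_le c D).inter
    (isCompact_setOf_sum_mul_le (fun x => (b x : ℝ)) B)).exists_isMaxOn hne
    (ch.continuousOn_info.mono fun _ hP => hP.1.1)

end Maximizer

/-! ### Random coding with threshold decoding -/

section RandomCoding

/-- Expected squared deviation of the empirical mean of `g` over an i.i.d. random codebook. -/
theorem sum_codebook_mul_sq_le {X κ : Type*} [Fintype X] [Fintype κ] [DecidableEq κ] {n : ℕ}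
    (hn : 0 < n) (hκ : 0 < Fintype.card κ) {P : X → ℝ} (hP : P ∈ stdSimplex ℝ X) (g : X → ℝ) :
    ∑ cb : κ → Fin n → X, (∏ w, ∏ i, P (cb w i)) *
        (1 / (n : ℝ) * ∑ i, (1 / (Fintype.card κ : ℝ) * ∑ w, g (cb w i)) - ∑ x, P x * g x) ^ 2
      ≤ (∑ x, P x * (g x - ∑ x, P x * g x) ^ 2) / n := by
  set m := ∑ x, P x * g x with hm
  have hn' : (n : ℝ) ≠ 0 := by positivity
  have hκ' : (Fintype.card κ : ℝ) ≠ 0 := by positivity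
  have hPn : ∑ x : Fin n → X, ∏ i, P (x i) = 1 := sum_iid hP.2
  have hg0 : ∑ x, P x * (g x - m) = 0 := by
    simp only [mul_sub, Finset.sum_sub_distrib, ← Finset.sum_mul, hP.2, ← hm]; ring
  have hdev : ∀ cb : κ → Fin n → X,
      1 / (n : ℝ) * ∑ i, (1 / (Fintype.card κ : ℝ) * ∑ w, g (cb w i)) - m
        = ∑ w, 1 / (Fintype.card κ : ℝ) * (1 / (n : ℝ) * ∑ i, (g (cb w i) - m)) := by
    intro cb
    simp only [Finset.sum_sub_distrib, mul_sub, ← Finset.mul_sum]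
    rw [Finset.sum_comm]
    simp
    field_simp
  calc _ ≤ ∑ cb : κ → Fin n → X, (∏ w, ∏ i, P (cb w i)) *
        ∑ w, 1 / (Fintype.card κ : ℝ) * (1 / (n : ℝ) * ∑ i, (g (cb w i) - m)) ^ 2 := by
        refine Finset.sum_le_sum fun cb _ => mul_le_mul_of_nonneg_left ?_
          (Finset.prod_nonneg fun _ _ => Finset.prod_nonneg fun _ _ => hP.1 _)
        -- Jensen over the messages: only the variance of a single codeword enters, so the bound
        -- does not depend on the number of messages.
        rw [hdev]
        exact sq_sum_mul_le (p := fun _ : κ => 1 / (Fintype.card κ : ℝ))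
          (fun _ => by positivity) (by simp [hκ'])
    _ = ∑ w : κ, 1 / (Fintype.card κ : ℝ) * ∑ cb : κ → Fin n → X, (∏ w, ∏ i, P (cb w i)) *
        (1 / (n : ℝ) * ∑ i, (g (cb w i) - m)) ^ 2 := by
        simp only [Finset.mul_sum]
        rw [Finset.sum_comm]
        exact Finset.sum_congr rfl fun _ _ => Finset.sum_congr rfl fun _ _ => by ring
    _ = ∑ w : κ, 1 / (Fintype.card κ : ℝ) * ((∑ x, P x * (g x - m) ^ 2) / n) := by
        refine Finset.sum_congr rfl fun w _ => ?_
        rw [sum_iid_mul_coord (p := fun x : Fin n → X => ∏ i, P (x i)) hPn w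
          (fun x => (1 / (n : ℝ) * ∑ i, (g (x i) - m)) ^ 2)]
        have h := sum_iid_mul_sq_sum (ι := Fin n) hP.2 (fun x => g x - m) hg0
        simp only [mul_pow, mul_left_comm _ ((1 / (n : ℝ)) ^ 2), ← Finset.mul_sum, h,
          Fintype.card_fin]
        field_simp
    _ = _ := by simp [hκ']
    _ ≤ _ := le_rfl

variable {X V κ : Type*} {n : ℕ}

/-- The threshold test: the likelihood of the output `v` given the codeword `x` exceeds `T` times
its probability under the output law `Q`. -/
def Passes (W : X → V → ℝ) (Q : V → ℝ) (T : ℝ) (x : Fin n → X) (v : Fin n → V) : Prop :=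
  T * ∏ i, Q (v i) ≤ ∏ i, W (x i) (v i)

open Classical in
/-- Decode to some message whose codeword passes the threshold test, if there is one. -/
def thresholdDecode [Nonempty κ] (W : X → V → ℝ) (Q : V → ℝ) (T : ℝ) (cb : κ → Fin n → X)
    (v : Fin n → V) : κ :=
  if h : ∃ w, Passes W Q T (cb w) v then h.choose else Classical.arbitrary κ

variable {W : X → V → ℝ} {P : X → ℝ}

open Classical in
-- If the true codeword passes, a wrong decision is itself another passing codeword; the sum is the
-- union bound.
theorem thresholdDecode_error_le [Fintype κ] [DecidableEq κ] [Nonempty κ] (Q : V → ℝ) (T : ℝ)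
    (cb : κ → Fin n → X) (v : Fin n → V) (w : κ) :
    (if thresholdDecode W Q T cb v ≠ w then (1 : ℝ) else 0)
      ≤ (if Passes W Q T (cb w) v then 0 else 1)
        + ∑ w' ∈ Finset.univ.erase w, if Passes W Q T (cb w') v then 1 else 0 := by
  have hnn : ∀ w' ∈ Finset.univ.erase w, (0 : ℝ) ≤ if Passes W Q T (cb w') v then 1 else 0 :=
    fun w' _ => by split_ifs <;> norm_num
  by_cases hw : Passes W Q T (cb w) v
  · by_cases hd : thresholdDecode W Q T cb v = w
    · simpa only [hd, hw, ne_eq, not_true_eq_false, if_true, if_false, zero_add]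
        using Finset.sum_nonneg hnn
    · have hex : ∃ w, Passes W Q T (cb w) v := ⟨w, hw⟩
      have hp : Passes W Q T (cb (thresholdDecode W Q T cb v)) v := by
        rw [thresholdDecode, dif_pos hex]
        exact hex.choose_spec
      have := Finset.single_le_sum hnn
        (Finset.mem_erase.2 ⟨hd, Finset.mem_univ (thresholdDecode W Q T cb v)⟩)
      rw [if_pos hp] at this
      simpa [hd, hw] using this
  · have := Finset.sum_nonneg hnn
    rw [if_neg hw]
    split_ifs <;> linarith

variable [Fintype X] [Fintype V]

open Classical in
-- On the passing event `Q` is at most `W / T`, and `P W` has total mass one.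
theorem sum_passes_le (hW : ∀ x v, 0 ≤ W x v) (hW1 : ∀ x, ∑ v, W x v = 1)
    (hP : P ∈ stdSimplex ℝ X) {T : ℝ} (hT : 0 < T) :
    ∑ v : Fin n → V, (∏ i, ∑ x, P x * W x (v i)) * ∑ x : Fin n → X, (∏ i, P (x i)) *
        (if Passes W (fun v => ∑ x, P x * W x v) T x v then 1 else 0) ≤ 1 / T := by
  have h1 : ∀ (v : Fin n → V) (x : Fin n → X), (∏ i, ∑ x, P x * W x (v i)) * ((∏ i, P (x i)) *
        (if Passes W (fun v => ∑ x, P x * W x v) T x v then 1 else 0))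
      ≤ 1 / T * ((∏ i, P (x i)) * ∏ i, W (x i) (v i)) := by
    intro v x
    have hPx : 0 ≤ ∏ i, P (x i) := Finset.prod_nonneg fun _ _ => hP.1 _
    by_cases h : Passes W (fun v => ∑ x, P x * W x v) T x v
    · rw [if_pos h, mul_one, mul_comm, mul_left_comm]
      refine mul_le_mul_of_nonneg_left ?_ hPx
      rw [one_div, inv_mul_eq_div, le_div_iff₀ hT, mul_comm]
      exact h
    · rw [if_neg h, mul_zero, mul_zero]
      exact mul_nonneg (by positivity) (mul_nonneg hPx (Finset.prod_nonneg fun _ _ => hW _ _))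
  calc _ ≤ ∑ v : Fin n → V, ∑ x : Fin n → X, 1 / T * ((∏ i, P (x i)) * ∏ i, W (x i) (v i)) := by
        refine Finset.sum_le_sum fun v _ => ?_
        rw [Finset.mul_sum]
        exact Finset.sum_le_sum fun x _ => h1 v x
    _ = 1 / T * ∑ x : Fin n → X, (∏ i, P (x i)) * ∑ v : Fin n → V, ∏ i, W (x i) (v i) := by
        rw [Finset.sum_comm]
        simp only [Finset.mul_sum]
    _ = 1 / T := by
        have h2 : ∀ x : Fin n → X, ∑ v : Fin n → V, ∏ i, W (x i) (v i) = 1 := fun x => by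
          rw [sum_prod_eq_prod_sum (fun i v => W (x i) v)]; simp [hW1]
        simp only [h2, mul_one, sum_iid hP.2]
    _ ≤ 1 / T := le_rfl

open Classical in
/-- The random coding bound for threshold decoding. -/
theorem sum_codebook_mul_error_le [Fintype κ] [DecidableEq κ] [Nonempty κ] (hW : ∀ x v, 0 ≤ W x v)
    (hW1 : ∀ x, ∑ v, W x v = 1) (hP : P ∈ stdSimplex ℝ X) {T : ℝ} (hT : 0 < T) :
    ∑ cb : κ → Fin n → X, (∏ w, ∏ i, P (cb w i)) * (1 / (Fintype.card κ : ℝ) *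
        ∑ w, ∑ v : Fin n → V, (∏ i, W (cb w i) (v i)) *
          (if thresholdDecode W (fun v => ∑ x, P x * W x v) T cb v ≠ w then 1 else 0))
      ≤ (∑ x : Fin n → X, (∏ i, P (x i)) * ∑ v : Fin n → V, (∏ i, W (x i) (v i)) *
          (if Passes W (fun v => ∑ x, P x * W x v) T x v then 0 else 1))
        + ((Fintype.card κ : ℝ) - 1) / T := by
  set Q : V → ℝ := fun v => ∑ x, P x * W x v with hQ
  have hκ' : (Fintype.card κ : ℝ) ≠ 0 := by positivity
  have hPn : ∑ x : Fin n → X, ∏ i, P (x i) = 1 := sum_iid hP.2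
  have hμ : ∀ cb : κ → Fin n → X, 0 ≤ ∏ w, ∏ i, P (cb w i) := fun cb =>
    Finset.prod_nonneg fun _ _ => Finset.prod_nonneg fun _ _ => hP.1 _
  set A := ∑ x : Fin n → X, (∏ i, P (x i)) * ∑ v : Fin n → V, (∏ i, W (x i) (v i)) *
          (if Passes W Q T x v then 0 else 1) with hA
  have hw : ∀ w : κ, ∑ cb : κ → Fin n → X, (∏ w, ∏ i, P (cb w i)) *
      ∑ v : Fin n → V, (∏ i, W (cb w i) (v i)) *
        (if thresholdDecode W Q T cb v ≠ w then 1 else 0)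
      ≤ A + ((Fintype.card κ : ℝ) - 1) / T := by
    intro w
    calc _ ≤ ∑ cb : κ → Fin n → X, (∏ w, ∏ i, P (cb w i)) *
          ∑ v : Fin n → V, (∏ i, W (cb w i) (v i)) *
            ((if Passes W Q T (cb w) v then 0 else 1)
              + ∑ w' ∈ Finset.univ.erase w, if Passes W Q T (cb w') v then 1 else 0) :=
          Finset.sum_le_sum fun cb _ => mul_le_mul_of_nonneg_left
            (Finset.sum_le_sum fun v _ => mul_le_mul_of_nonneg_left
              (thresholdDecode_error_le Q T cb v w)
              (Finset.prod_nonneg fun _ _ => hW _ _)) (hμ cb)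
      _ = (∑ cb : κ → Fin n → X, (∏ w, ∏ i, P (cb w i)) *
            ∑ v : Fin n → V, (∏ i, W (cb w i) (v i)) *
              (if Passes W Q T (cb w) v then 0 else 1))
          + ∑ w' ∈ Finset.univ.erase w, ∑ v : Fin n → V, ∑ cb : κ → Fin n → X,
              (∏ w, ∏ i, P (cb w i)) * ((∏ i, W (cb w i) (v i)) *
                (if Passes W Q T (cb w') v then 1 else 0)) := by
          simp only [mul_add, Finset.sum_add_distrib]
          congr 1
          simp only [Finset.mul_sum]
          exact (Finset.sum_congr rfl fun cb _ => Finset.sum_comm).trans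
            (Finset.sum_comm.trans (Finset.sum_congr rfl fun w' _ => Finset.sum_comm))
      _ ≤ A + ∑ w' ∈ Finset.univ.erase w, 1 / T := by
          refine add_le_add (le_of_eq ?_) (Finset.sum_le_sum fun w' hw' => ?_)
          · exact sum_iid_mul_coord (p := fun x : Fin n → X => ∏ i, P (x i)) hPn w
              (fun x => ∑ v : Fin n → V, (∏ i, W (x i) (v i)) *
                (if Passes W Q T x v then 0 else 1))
          · refine le_trans (le_of_eq ?_) (sum_passes_le (n := n) hW hW1 hP hT)
            refine Finset.sum_congr rfl fun v _ => ?_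
            -- The two codewords are independent; averaging over the transmitted one turns the
            -- channel into its output law `Q`.
            rw [sum_iid_mul_coord_mul_coord (p := fun x : Fin n → X => ∏ i, P (x i)) hPn
              (Finset.ne_of_mem_erase hw').symm (fun x => ∏ i, W (x i) (v i))
              (fun x => if Passes W Q T x v then 1 else 0)]
            congr 1
            simp only [← Finset.prod_mul_distrib]
            exact sum_prod_eq_prod_sum (fun i x => P x * W x (v i))
      _ = _ := by
          rw [Finset.sum_const, Finset.card_erase_of_mem (Finset.mem_univ w), Finset.card_univ,
            nsmul_eq_mul, Nat.cast_sub Fintype.card_pos, Nat.cast_one, mul_one_div]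
  calc _ = 1 / (Fintype.card κ : ℝ) * ∑ w : κ, ∑ cb : κ → Fin n → X, (∏ w, ∏ i, P (cb w i)) *
        ∑ v : Fin n → V, (∏ i, W (cb w i) (v i)) *
          (if thresholdDecode W Q T cb v ≠ w then 1 else 0) := by
        rw [Finset.sum_comm, Finset.mul_sum]
        refine Finset.sum_congr rfl fun cb _ => ?_
        rw [← Finset.mul_sum]
        ring
    _ ≤ 1 / (Fintype.card κ : ℝ) * ∑ w : κ, (A + ((Fintype.card κ : ℝ) - 1) / T) :=
        mul_le_mul_of_nonneg_left (Finset.sum_le_sum fun w _ => hw w) (by positivity)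
    _ = _ := by
        rw [Finset.sum_const, Finset.card_univ, nsmul_eq_mul, ← mul_assoc,
          one_div_mul_cancel hκ', one_mul]

open Classical in
/-- The true codeword fails a threshold test below the mean information density with
probability decaying by Chebyshev's inequality. -/
theorem sum_not_passes_le (hn : 0 < n) (hW : ∀ x v, 0 ≤ W x v) (hW1 : ∀ x, ∑ v, W x v = 1)
    (hP : P ∈ stdSimplex ℝ X) {L : X → V → ℝ} {I δ : ℝ} (hδ : 0 < δ)
    (hL : ∀ x v, 0 < P x → 0 < W x v → Real.exp (L x v) * (∑ x, P x * W x v) = W x v)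
    (hI : ∑ x, ∑ v, P x * W x v * L x v = I) :
    ∑ x : Fin n → X, (∏ i, P (x i)) * ∑ v : Fin n → V, (∏ i, W (x i) (v i)) *
        (if Passes W (fun v => ∑ x, P x * W x v) (Real.exp (n * (I - δ))) x v then 0 else 1)
      ≤ (∑ x, ∑ v, P x * W x v * (L x v - I) ^ 2) / δ ^ 2 / n := by
  have hn' : (0 : ℝ) < n := by exact_mod_cast hn
  set Q : V → ℝ := fun v => ∑ x, P x * W x v with hQ
  have hJ : ∑ u : X × V, P u.1 * W u.1 u.2 = 1 := by
    rw [Fintype.sum_prod_type]; simp only [← Finset.mul_sum, hW1, mul_one, hP.2]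
  have hJ0 : ∑ u : X × V, P u.1 * W u.1 u.2 * (L u.1 u.2 - I) = 0 := by
    simp only [mul_sub, Finset.sum_sub_distrib, ← Finset.sum_mul, hJ]
    rw [Fintype.sum_prod_type, hI]; ring
  have hpt : ∀ (x : Fin n → X) (v : Fin n → V), (∏ i, P (x i)) * ((∏ i, W (x i) (v i)) *
        (if Passes W Q (Real.exp (n * (I - δ))) x v then 0 else 1))
      ≤ (∏ i, P (x i) * W (x i) (v i)) * (∑ i, (L (x i) (v i) - I)) ^ 2 / (n * δ) ^ 2 := by
    intro x v
    rw [← mul_assoc, ← Finset.prod_mul_distrib, mul_div_assoc]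
    have hnn : ∀ i ∈ Finset.univ, 0 ≤ P (x i) * W (x i) (v i) :=
      fun i _ => mul_nonneg (hP.1 _) (hW _ _)
    by_cases h0 : ∏ i, P (x i) * W (x i) (v i) = 0
    · simp [h0]
    refine mul_le_mul_of_nonneg_left ?_ (Finset.prod_nonneg hnn)
    split_ifs with hpass
    · positivity
    · have hfac : ∀ i, 0 < P (x i) ∧ 0 < W (x i) (v i) := fun i => by
        have h := Finset.prod_ne_zero_iff.1 h0 i (Finset.mem_univ i)
        exact ⟨lt_of_le_of_ne (hP.1 _) (left_ne_zero_of_mul h).symm,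
          lt_of_le_of_ne (hW _ _) (right_ne_zero_of_mul h).symm⟩
      have hprod : ∏ i, W (x i) (v i) = Real.exp (∑ i, L (x i) (v i)) * ∏ i, Q (v i) := by
        rw [Real.exp_sum, ← Finset.prod_mul_distrib]
        exact Finset.prod_congr rfl fun i _ => (hL _ _ (hfac i).1 (hfac i).2).symm
      have hQpos : 0 < ∏ i, Q (v i) := by
        have h1 : 0 < ∏ i, W (x i) (v i) := Finset.prod_pos fun i _ => (hfac i).2
        rw [hprod] at h1
        exact (pos_iff_pos_of_mul_pos h1).1 (Real.exp_pos _)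
      -- Failure now reads `∑ L < n (I - δ)`, a deviation of more than `n δ` below the mean, so the
      -- squared deviation over `(n δ) ^ 2` dominates the indicator.
      rw [Passes, hprod, not_le, mul_lt_mul_iff_left₀ hQpos, Real.exp_lt_exp] at hpass
      rw [le_div_iff₀ (by positivity), one_mul, sq_le_sq, abs_of_pos (by positivity : 0 < n * δ)]
      refine le_trans ?_ (neg_le_abs _)
      rw [Finset.sum_sub_distrib, Finset.sum_const, Finset.card_univ, Fintype.card_fin,
        nsmul_eq_mul]
      linarith
  calc _ ≤ ∑ x : Fin n → X, ∑ v : Fin n → V,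
        (∏ i, P (x i) * W (x i) (v i)) * (∑ i, (L (x i) (v i) - I)) ^ 2 / (n * δ) ^ 2 := by
        refine Finset.sum_le_sum fun x _ => ?_
        rw [Finset.mul_sum]
        exact Finset.sum_le_sum fun v _ => hpt x v
    _ = (∑ u : Fin n → X × V, (∏ i, P (u i).1 * W (u i).1 (u i).2) *
          (∑ i, (L (u i).1 (u i).2 - I)) ^ 2) / (n * δ) ^ 2 := by
        simp only [← Finset.sum_div]
        rw [← (Equiv.arrowProdEquivProdArrow (Fin n) (fun _ => X) (fun _ => V)).symm.sum_comp,
          Fintype.sum_prod_type]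
        rfl
    _ = _ := by
        rw [sum_iid_mul_sq_sum (ι := Fin n) hJ (fun u => L u.1 u.2 - I) hJ0, Fintype.card_fin,
          Fintype.sum_prod_type]
        field_simp

end RandomCoding

/-! ### Achievability -/

section Achievability

open Filter Topology

variable {X S Y Z Shat : Type*} [Fintype S] [Fintype Y] [Fintype Z] (ch : Channel X S Y Z)

/-- The channel whose output is the state together with the received symbol. -/
def Channel.lawSY (x : X) (v : S × Y) : ℝ := ch.stateDist v.1 * ch.lawY x v.1 v.2

theorem Channel.lawSY_nonneg (x : X) (v : S × Y) : 0 ≤ ch.lawSY x v :=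
  mul_nonneg (ch.stateDist_nonneg _) (ch.lawY_nonneg _ _ _)

theorem Channel.sum_lawSY (x : X) : ∑ v, ch.lawSY x v = 1 := by
  rw [Fintype.sum_prod_type]
  simp only [Channel.lawSY, ← Finset.mul_sum, ch.sum_lawY, mul_one, ch.stateDist_mem.2]

variable {M n : ℕ}

/-- The code that ignores the feedback, sends the codewords of `cb`, decodes with `dec` and
estimates symbol by symbol with `e`. -/
def codebookCode (cb : Fin M → Fin n → X) (dec : (Fin n → S × Y) → Fin M) (e : X → Z → Shat) :
    Code X S Y Z Shat M n where
  encode i w _ := cb w i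
  decode s y := dec fun i => (s i, y i)
  estimate x z i := e (x i) (z i)

theorem Code.expect_message (C : Code X S Y Z Shat M n) (f : Fin M → ℝ) :
    C.expect ch (fun w _ _ _ => f w) = 1 / (M : ℝ) * ∑ w, f w := by
  rw [C.expect_eq]
  simp only [← Finset.sum_mul, C.sum_pathProb, one_mul]

variable (cb : Fin M → Fin n → X) (dec : (Fin n → S × Y) → Fin M)

theorem codebookCode_cost (e : X → Z → Shat) (b : X → ℝ≥0) :
    (codebookCode cb dec e).cost ch b
      = 1 / (n : ℝ) * ∑ i, (1 / (M : ℝ) * ∑ w, (b (cb w i) : ℝ)) := by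
  rw [Code.cost]
  congr 1
  exact Finset.sum_congr rfl fun i _ => Code.expect_message ch _ fun w => (b (cb w i) : ℝ)

theorem codebookCode_distortion (e : X → Z → Shat) (d : S → Shat → ℝ≥0) :
    (codebookCode cb dec e).distortion ch d
      = 1 / (n : ℝ) * ∑ i, (1 / (M : ℝ) * ∑ w, ch.estCost d e (cb w i)) := by
  rw [Code.distortion]
  congr 1
  refine Finset.sum_congr rfl fun i _ => ?_
  rw [← Code.expect_message ch (codebookCode cb dec e) fun w => ch.estCost d e (cb w i)]
  have h := (codebookCode cb dec e).expect_local ch i (fun x v => (d v.1 (e x v.2.2) : ℝ))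
  simp only [Channel.sum_kernel_mul_dist] at h
  exact h

theorem codebookCode_errorProb (e : X → Z → Shat) :
    (codebookCode cb dec e).errorProb ch = 1 / (M : ℝ) * ∑ w, ∑ v : Fin n → S × Y,
      (∏ i, ch.lawSY (cb w i) (v i)) * (if dec v ≠ w then 1 else 0) := by
  rw [Code.errorProb, Code.expect, Finset.mul_sum]
  refine Finset.sum_congr rfl fun w _ => ?_
  rw [← (Equiv.arrowProdEquivProdArrow (Fin n) (fun _ => S) (fun _ => Y)).symm.sum_comp,
    Fintype.sum_prod_type, Finset.mul_sum]
  refine Finset.sum_congr rfl fun s _ => ?_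
  rw [Finset.mul_sum]
  refine Finset.sum_congr rfl fun y _ => ?_
  rw [← Finset.sum_mul, ← mul_assoc]
  congr 1
  simp only [Code.jointLaw, ← Finset.mul_sum]
  congr 1
  have h := sum_prod_eq_prod_sum (fun (i : Fin n) (z : Z) =>
    ch.stateDist (s i) * ch.law (cb w i) (s i) (y i, z))
  simp only [← Finset.mul_sum] at h
  exact h

/-- All three terms are nonnegative, so each tends to zero, and both limsups are limits. Length zero
is exempt: its averages are zero whatever `m` and `c` are. -/
theorem achievable_of_forall_code {d : S → Shat → ℝ≥0} {b : X → ℝ≥0} {R D B m c : ℝ}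
    (hR : 0 ≤ R) (hmB : m ≤ B) (hcD : c ≤ D) {M : ℕ → ℕ} {r : ℕ → ℝ}
    (hM : ∀ n : ℕ, (2 : ℝ) ^ ((n : ℝ) * R) ≤ (M n : ℝ)) (hr : Tendsto r atTop (𝓝 0))
    (h : ∀ n, ∃ C : Code X S Y Z Shat (M n) n, 0 < n →
      C.errorProb ch + (C.cost ch b - m) ^ 2 + (C.distortion ch d - c) ^ 2 ≤ r n) :
    Achievable ch d b R D B := by
  choose C hC using h
  have hlim : ∀ u : ℕ → ℝ, ∀ a : ℝ, (∀ n, 0 < n → (u n - a) ^ 2 ≤ r n) →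
      Tendsto u atTop (𝓝 a) := by
    intro u a hu
    rw [tendsto_iff_norm_sub_tendsto_zero]
    have hs := hr.sqrt
    rw [Real.sqrt_zero] at hs
    refine squeeze_zero' (Eventually.of_forall fun n => norm_nonneg _) ?_ hs
    filter_upwards [eventually_gt_atTop 0] with n hn
    exact Real.abs_le_sqrt (hu n hn)
  have herr : ∀ n, 0 ≤ (C n).errorProb ch := fun n => by
    rw [Code.errorProb, Code.expect]
    refine Finset.sum_nonneg fun w _ => Finset.sum_nonneg fun s _ => Finset.sum_nonneg fun y _ =>
      Finset.sum_nonneg fun z _ => mul_nonneg ((C n).jointLaw_nonneg ch _ _ _ _) ?_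
    split_ifs <;> norm_num
  refine ⟨hR, M, C, hM, ?_, ?_, ?_⟩
  · refine squeeze_zero' (Eventually.of_forall herr) ?_ hr
    filter_upwards [eventually_gt_atTop 0] with n hn
    nlinarith [hC n hn, sq_nonneg ((C n).cost ch b - m), sq_nonneg ((C n).distortion ch d - c)]
  · refine (hlim _ c fun n hn => ?_).limsup_eq.trans_le hcD
    nlinarith [hC n hn, herr n, sq_nonneg ((C n).cost ch b - m)]
  · refine (hlim _ m fun n hn => ?_).limsup_eq.trans_le hmB
    nlinarith [hC n hn, herr n, sq_nonneg ((C n).distortion ch d - c)]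

variable [Fintype X]

theorem Channel.sum_mul_lawSY (P : X → ℝ) (v : S × Y) :
    ∑ x, P x * ch.lawSY x v = ch.stateDist v.1 * ch.outY P v.1 v.2 := by
  rw [Channel.outY, Finset.mul_sum]
  exact Finset.sum_congr rfl fun x _ => by rw [Channel.lawSY]; ring

/-- Codes whose error probability, cost and distortion are controlled simultaneously. -/
theorem exists_code_of_info (d : S → Shat → ℝ≥0) (b : X → ℝ≥0) (e : X → Z → Shat) {P : X → ℝ}
    (hP : P ∈ stdSimplex ℝ X) {δ : ℝ} (hδ : 0 < δ) :
    ∃ K : ℝ, ∀ M n : ℕ, 0 < M → 0 < n → ∃ C : Code X S Y Z Shat M n,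
      C.errorProb ch + (C.cost ch b - ∑ x, P x * (b x : ℝ)) ^ 2
          + (C.distortion ch d - ∑ x, P x * ch.estCost d e x) ^ 2
        ≤ K / n + ((M : ℝ) - 1) / Real.exp (n * (ch.info P * Real.log 2 - δ)) := by
  classical
  set I := ch.info P * Real.log 2 with hI
  set L : X → S × Y → ℝ := fun x v => ch.infoDensity P x v.1 v.2 with hLdef
  refine ⟨(∑ x, ∑ v, P x * ch.lawSY x v * (L x v - I) ^ 2) / δ ^ 2
    + ∑ x, P x * ((b x : ℝ) - ∑ x, P x * (b x : ℝ)) ^ 2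
    + ∑ x, P x * (ch.estCost d e x - ∑ x, P x * ch.estCost d e x) ^ 2, fun M n hM hn => ?_⟩
  have : Nonempty (Fin M) := ⟨⟨0, hM⟩⟩
  have hL : ∀ x v, 0 < P x → 0 < ch.lawSY x v →
      Real.exp (L x v) * (∑ x, P x * ch.lawSY x v) = ch.lawSY x v := by
    intro x v hPx hW
    have hY : 0 < ch.lawY x v.1 v.2 := lt_of_le_of_ne (ch.lawY_nonneg _ _ _)
      (right_ne_zero_of_mul hW.ne').symm
    have hq := (mul_pos hPx hY).trans_le (ch.mul_lawY_le_outY hP _ _ _)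
    rw [ch.sum_mul_lawSY, hLdef]
    simp only [Channel.infoDensity, Channel.lawSY]
    rw [Real.exp_log (div_pos hY hq)]
    field_simp
  have hmean : ∑ x, ∑ v, P x * ch.lawSY x v * L x v = I := by
    rw [hI, ch.info_mul_log_two hP]
    refine Finset.sum_congr rfl fun x _ => ?_
    rw [Fintype.sum_prod_type]
    simp only [Channel.lawSY, hLdef, mul_assoc]
  have hE := sum_codebook_mul_error_le (κ := Fin M) (n := n) ch.lawSY_nonneg ch.sum_lawSY hP
    (Real.exp_pos (n * (I - δ)))
  have hF := sum_not_passes_le hn ch.lawSY_nonneg ch.sum_lawSY hP hδ hL hmean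
  have hB := sum_codebook_mul_sq_le (κ := Fin M) hn (by simpa using hM) hP (fun x => (b x : ℝ))
  have hD := sum_codebook_mul_sq_le (κ := Fin M) hn (by simpa using hM) hP (ch.estCost d e)
  rw [Fintype.card_fin] at hE hB hD
  set T := Real.exp (n * (I - δ))
  set dec : (Fin M → Fin n → X) → (Fin n → S × Y) → Fin M :=
    thresholdDecode ch.lawSY (fun v => ∑ x, P x * ch.lawSY x v) T
  -- One codebook does at least as well as the mean of the sum, hence serves all three criteria at
  -- once.
  obtain ⟨cb, hcb⟩ := exists_le_of_sum_mul_le (p := fun cb : Fin M → Fin n → X =>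
      ∏ w, ∏ i, P (cb w i))
    (f := fun cb => (codebookCode cb (dec cb) e).errorProb ch
      + ((codebookCode cb (dec cb) e).cost ch b - ∑ x, P x * (b x : ℝ)) ^ 2
      + ((codebookCode cb (dec cb) e).distortion ch d - ∑ x, P x * ch.estCost d e x) ^ 2)
    (fun cb => Finset.prod_nonneg fun _ _ => Finset.prod_nonneg fun _ _ => hP.1 _)
    (sum_iid (p := fun x : Fin n → X => ∏ i, P (x i)) (sum_iid hP.2))
    (r := _) (by
      simp only [mul_add, Finset.sum_add_distrib, codebookCode_cost, codebookCode_distortion,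
        codebookCode_errorProb]
      exact add_le_add (add_le_add (hE.trans (add_le_add_left hF _)) hB) hD)
  refine ⟨codebookCode cb (dec cb) e, hcb.trans (le_of_eq ?_)⟩
  ring

theorem achievable_of_tendsto {d : S → Shat → ℝ≥0} {b : X → ℝ≥0} {e : X → Z → Shat}
    {P : X → ℝ} {R D B δ : ℝ} (hP : P ∈ distortionSet (ch.estCost d e) D ∩ costSet b B)
    (hR : 0 ≤ R) (hδ : 0 < δ)
    (hlim : Tendsto (fun n : ℕ => ((⌈(2 : ℝ) ^ ((n : ℝ) * R)⌉₊ : ℝ) - 1) /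
      Real.exp (n * (ch.info P * Real.log 2 - δ))) atTop (𝓝 0)) :
    Achievable ch d b R D B := by
  obtain ⟨K, hK⟩ := exists_code_of_info ch d b e hP.1.1 hδ
  have hMpos : ∀ n : ℕ, 0 < ⌈(2 : ℝ) ^ ((n : ℝ) * R)⌉₊ := fun n =>
    Nat.ceil_pos.2 (Real.rpow_pos_of_pos two_pos _)
  refine achievable_of_forall_code ch hR hP.2.2 hP.1.2 (fun n => Nat.le_ceil _)
    (by simpa using (tendsto_const_div_atTop_nhds_zero_nat K).add hlim) fun n => ?_
  rcases Nat.eq_zero_or_pos n with rfl | hn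
  · exact ⟨⟨fun i => i.elim0, fun _ _ => ⟨0, hMpos 0⟩, fun _ _ i => i.elim0⟩,
      fun h => absurd h (lt_irrefl 0)⟩
  · obtain ⟨C, hC⟩ := hK _ n (hMpos n) hn
    exact ⟨C, fun _ => hC⟩

/-- At rate zero there is one message, so the `M - 1` term is zero even if the information vanishes.
This makes the set of achievable rates nonempty. -/
theorem achievable_zero {d : S → Shat → ℝ≥0} {b : X → ℝ≥0} {e : X → Z → Shat}
    {P : X → ℝ} {D B : ℝ} (hP : P ∈ distortionSet (ch.estCost d e) D ∩ costSet b B) :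
    Achievable ch d b 0 D B :=
  achievable_of_tendsto ch hP le_rfl one_pos (by simp)

theorem achievable_of_lt_info {d : S → Shat → ℝ≥0} {b : X → ℝ≥0} {e : X → Z → Shat}
    {P : X → ℝ} {R D B : ℝ} (hP : P ∈ distortionSet (ch.estCost d e) D ∩ costSet b B)
    (hR : 0 ≤ R) (hRI : R < ch.info P) : Achievable ch d b R D B := by
  have h2 : 0 < Real.log 2 := Real.log_pos one_lt_two
  -- Half the gap in nats: one half is spent in the threshold, the other leaves the decay `exp (-n
  -- δ)`.
  set δ := (ch.info P - R) * Real.log 2 / 2 with hδ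
  have hδpos : 0 < δ := by
    have := mul_pos (sub_pos.2 hRI) h2
    positivity
  refine achievable_of_tendsto ch hP hR hδpos ?_
  have hexp : Tendsto (fun n : ℕ => Real.exp (-(n * δ))) atTop (𝓝 0) :=
    Real.tendsto_exp_neg_atTop_nhds_zero.comp
      (tendsto_natCast_atTop_atTop.atTop_mul_const hδpos)
  refine squeeze_zero (fun n => ?_) (fun n => ?_) hexp
  · refine div_nonneg (sub_nonneg.2 ?_) (Real.exp_pos _).le
    exact_mod_cast Nat.ceil_pos.2 (Real.rpow_pos_of_pos two_pos _)
  · have hc := Nat.ceil_lt_add_one (Real.rpow_nonneg two_pos.le ((n : ℝ) * R))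
    rw [div_le_iff₀ (Real.exp_pos _), ← Real.exp_add]
    refine (sub_le_iff_le_add.2 hc.le).trans (le_of_eq ?_)
    rw [Real.rpow_def_of_pos two_pos, hδ]
    congr 1
    ring

end Achievability

end SDMC

end

/-! ### The capacity formula -/

theorem theorem1 {X S Y Z Shat : Type*} [Fintype X] [Fintype S] [Fintype Y] [Fintype Z]
    [Fintype Shat] [Nonempty Shat]
    (ch : SDMC.Channel X S Y Z) (d : S → Shat → ℝ≥0) (b : X → ℝ≥0)
    (e : X → Z → Shat) (he : ch.IsOptimalEstimator d e)
    (D B : ℝ) (hB : 0 ≤ B) (hfeas : (SDMC.costSet b B).Nonempty)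
    (hD : SDMC.minDistortion (ch.estCost d e) b B ≤ D) :
    IsLUB {R : ℝ | SDMC.Achievable ch d b R D B} (SDMC.capacity ch d b D B) ∧
    IsGreatest (ch.info '' (SDMC.distortionSet (ch.estCost d e) D ∩ SDMC.costSet b B))
      (SDMC.infoTradeoff ch d b e D B) ∧
    SDMC.capacity ch d b D B = SDMC.infoTradeoff ch d b e D B := by
  obtain ⟨P, hP, hmax⟩ := ch.exists_isMaxOn_info
    (SDMC.distortionSet_inter_costSet_nonempty hfeas hD)
  have hgr : IsGreatest (ch.info '' (SDMC.distortionSet (ch.estCost d e) D ∩ SDMC.costSet b B))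
      (ch.info P) :=
    ⟨⟨P, hP, rfl⟩, by rintro _ ⟨Q, hQ, rfl⟩; exact hmax hQ⟩
  have htr : SDMC.infoTradeoff ch d b e D B = ch.info P := hgr.csSup_eq
  have hlub : IsLUB {R : ℝ | SDMC.Achievable ch d b R D B} (ch.info P) := by
    constructor
    · intro R hR
      obtain ⟨Q, hQ, hRQ⟩ := hR.exists_le_info he
      exact hRQ.trans (hmax hQ)
    · intro u hu
      -- Needed so that the rate chosen between `u` and the information is nonnegative, as
      -- achievability demands.
      have h0 : 0 ≤ u := hu (SDMC.achievable_zero ch hP)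
      by_contra! hlt
      obtain ⟨R, huR, hRI⟩ := exists_between hlt
      exact huR.not_ge (hu (SDMC.achievable_of_lt_info ch hP (h0.trans huR.le) hRI))
  have hcap : SDMC.capacity ch d b D B = ch.info P :=
    hlub.csSup_eq ⟨0, SDMC.achievable_zero ch hP⟩
  rw [hcap, htr]
  exact ⟨hlub, hgr, rfl⟩
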